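/- Let $H=L^2(\mathbb R,dt)$ (real-valued functions), $H_{\mathbb C}=L^2(\mathbb R,\mathbb C,dt)$, with the bilinear form $\langle\xi,\eta\rangle=\int\xi\eta\,dt$. Let $A$ be a positive self-adjoint operator in $H$ with $\inf\sigma(A)>1$ and Hilbert–Schmidt inverse. For $p\in\mathbb R$ put $|f|_p=|(A^{\otimes n})^p f|_0$ for tensors $f$ of order $n$ (where $|\cdot|_0$ is the Hilbert norm of $H_{\mathbb C}^{\otimes n}$), and let $E_{\mathbb C}=\{\xi\in H_{\mathbb C}: |\xi|_p<\infty \text{ for all } p\in\mathbb R\}$. Let $0\le\beta<1$. Via the Wiener–Itô chaos decomposition, let $(E)_\beta$ be the space of all $\varphi\sim(f_n)_{n\ge0}$, $f_n\in H_{\mathbb C}^{\hat\otimes n}$ (symmetric tensors), such that $$|\varphi|_{p,\beta}=\Big(\sum_{n=0}^\infty (n!)^{1+\beta}|f_n|_p^2\Big)^{1/2}<\infty\quad\text{for all }p\in\mathbb R,$$ with the locally convex topology defined by the norms $|\cdot|_{p,\beta}$, and let $(E)_\beta^*$ be its topological dual with the strong topology and $\langle\!\langle\cdot,\cdot\rangle\!\rangle$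 the dual pairing. For $\xi\in E_{\mathbb C}$ let $\Phi_\xi\sim(\xi^{\otimes n}/n!)_{n\ge 0}\in(E)_\beta$, and for $\Psi\in(E)_\beta^*$ let $S(\Psi)(\xi)=\langle\!\langle\Psi,\Phi_\xi\rangle\!\rangle$, $\xi\in E_{\mathbb C}$, be its $S$-transform. Let $L((E)_\beta,(E)_\beta)$, the space of continuous linear operators on $(E)_\beta$, carry the topology of uniform convergence on bounded sets. Then $S$ is injective, and for all $\varphi,\psi\in(E)_\beta^*$ the Wick product $\varphi\diamond\psi=S^{-1}(S(\varphi)\cdot S(\psi))\in(E)_\beta^*$ exists. For each $\varphi\in(E)_\beta^*$ the Wick multiplication $\widetilde M_\varphi:\psi\mapsto\varphi\diamond\psi$ is a continuous linear operator on $(E)_\beta^*$, and it has a dual operator $C_\varphi\in L((E)_\beta,(E)_\beta)$ (the convolution operator), given by $\langle\!\langle\psi,C_\varphi f\rangle\!\rangle=\langle\!\langle\varphi\diamond\psi,f\rangle\!\rangle$ for all $\psi\in(E)_\beta^*$, $f\in(E)_\beta$. The map $$C:((E)_\beta^*,+,\cdot,\diamond)\to(L((E)_\beta,(E)_\beta),+,\cdot,\circ),\qquad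 \varphi\mapsto C_\varphi,$$ is an injective, continuous homomorphism of algebras: it is linear, $C_{\varphi\diamond\psi}=C_\varphi\circ C_\psi$ for all $\varphi,\psi$, and it maps the unit of $\diamond$ to the identity operator. Moreover $C$ is a topological isomorphism of $(E)_\beta^*$ onto its image $\mathrm{Im}(C)$ with the subspace topology. -/

import Mathlib

open MeasureTheory
open scoped ENNReal

noncomputable section

namespace WhiteNoise

/-- The real Hilbert space `H = L²(ℝ, dt)`. -/
abbrev RealL2 : Type := Lp ℝ 2 (volume : Measure ℝ)

/-- Its complexification `H_ℂ = L²(ℝ, ℂ, dt)`. -/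
abbrev ComplexL2 : Type := Lp ℂ 2 (volume : Measure ℝ)

/-- The (real) spectrum of a closed operator `A` in a real Hilbert space: the `z` for which
`A - z : D(A) → H` is not bijective (for a closed operator a bijective `A - z` has a bounded
inverse). For self-adjoint `A` this is the spectrum of the complexification of `A`. -/
def opSpectrum (A : RealL2 →ₗ.[ℝ] RealL2) : Set ℝ :=
  {z | ¬ Function.Bijective fun x : A.domain => A x - z • (x : RealL2)}

/-- The operators `A` that define the Gel'fand triple `E ⊂ L²(ℝ, dt) ⊂ E*`: positive self-adjoint
(in general unbounded) operators with `inf σ(A) > 1` whose inverse is Hilbert-Schmidt. -/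
structure TripleOperator where
  op : RealL2 →ₗ.[ℝ] RealL2
  selfAdjoint : IsSelfAdjoint op
  positive : ∀ x : op.domain, 0 ≤ inner ℝ (op x) (x : RealL2)
  one_lt_inf_spectrum : 1 < sInf (opSpectrum op)
  hilbertSchmidt_inverse : ∃ K : RealL2 →L[ℝ] RealL2,
    (∀ y, ∃ h : K y ∈ op.domain, op ⟨K y, h⟩ = y) ∧ (∀ x : op.domain, K (op x) = x) ∧
    ∃ (ι : Type) (b : HilbertBasis ι ℝ RealL2), Summable fun i => ‖K (b i)‖ ^ 2

/-! ### The eigenbasis of `A` -/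

section Spectral

variable {H : Type} [NormedAddCommGroup H] [InnerProductSpace ℝ H] [CompleteSpace H]

theorem isCompactOperator_of_summable {ι : Type} (b : HilbertBasis ι ℝ H) (K : H →L[ℝ] H)
    (hK : Summable fun i => ‖K (b i)‖ ^ 2) : IsCompactOperator K := by
  classical
  let F : Finset ι → H →L[ℝ] H := fun s => ∑ i ∈ s, (innerSL ℝ (b i)).smulRight (K (b i))
  have hFc : ∀ s, IsCompactOperator (F s) := by
    intro s
    have : F s ∈ compactOperator (RingHom.id ℝ) H H := by
      refine Submodule.sum_mem _ fun i _ => ?_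
      change IsCompactOperator ((innerSL ℝ (b i)).smulRight (K (b i)))
      have h1 : IsCompactOperator (ContinuousLinearMap.toSpanSingleton ℝ (K (b i))) := by
        have := (isCompactOperator_id_iff_finiteDimensional (𝕜 := ℝ) (E := ℝ)).2 inferInstance
        exact this.clm_comp (ContinuousLinearMap.toSpanSingleton ℝ (K (b i)))
      exact h1.comp_clm (innerSL ℝ (b i))
    exact this
  have htail := (tendsto_tsum_compl_atTop_zero fun i => ‖K (b i)‖ ^ 2)
  have hbound : ∀ s, ‖F s - K‖ ≤ Real.sqrt (∑' i : {x // x ∉ s}, ‖K (b i)‖ ^ 2) := by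
    intro s
    refine ContinuousLinearMap.opNorm_le_bound _ (Real.sqrt_nonneg _) fun x => ?_
    have hx : HasSum (fun i => b.repr x i • K (b i)) (K x) := by
      simpa using (b.hasSum_repr x).mapL K
    have hFx : F s x = ∑ i ∈ s, b.repr x i • K (b i) := by
      simp [F, b.repr_apply_apply]
    have h2 : HasSum (fun i : {x // x ∉ s} => b.repr x i • K (b i)) (K x - F s x) := by
      rw [hFx]
      refine (Finset.hasSum_compl_iff (f := fun i => b.repr x i • K (b i)) s).2 ?_
      rw [sub_add_cancel]
      exact hx
    rw [sub_apply, norm_sub_rev]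
    refine le_of_tendsto h2.norm (Filter.Eventually.of_forall fun t => ?_)
    refine (norm_sum_le _ _).trans ?_
    simp only [norm_smul]
    refine (Real.sum_mul_le_sqrt_mul_sqrt t _ _).trans ?_
    rw [mul_comm]
    have hb : ∑ i ∈ t, ‖b.repr x i‖ ^ 2 ≤ ‖x‖ ^ 2 := by
      have := b.orthonormal.sum_inner_products_le x (s := t.map (Function.Embedding.subtype _))
      simpa [b.repr_apply_apply] using this
    refine mul_le_mul (Real.sqrt_le_sqrt ?_) ?_ (Real.sqrt_nonneg _) (Real.sqrt_nonneg _)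
    · exact (hK.subtype _).sum_le_tsum t fun i _ => by positivity
    · exact (Real.sqrt_le_sqrt hb).trans (by rw [Real.sqrt_sq (norm_nonneg _)])
  refine isCompactOperator_of_tendsto (F := F) (l := Filter.atTop) ?_ (Filter.Eventually.of_forall hFc)
  rw [tendsto_iff_norm_sub_tendsto_zero]
  refine squeeze_zero (fun _ => norm_nonneg _) hbound ?_
  simpa using htail.sqrt

theorem exists_hilbertBasis_eigenvectors (T : H →L[ℝ] H) (hT : IsCompactOperator T)
    (hs : (T : H →ₗ[ℝ] H).IsSymmetric) :
    ∃ (ι : Type) (b : HilbertBasis ι ℝ H) (c : ι → ℝ), ∀ i, T (b i) = c i • b i := by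
  classical
  let V : ℝ → Submodule ℝ H := fun μ => Module.End.eigenspace (T : H →ₗ[ℝ] H) μ
  have hVmem : ∀ μ x, x ∈ V μ ↔ T x = μ • x := fun μ x => Module.End.mem_eigenspace_iff
  have hVc : ∀ μ, CompleteSpace (V μ) := by
    intro μ
    have : IsClosed (V μ : Set H) := by
      have : (V μ : Set H) = {x | T x = μ • x} := by ext x; exact hVmem μ x
      rw [this]
      exact isClosed_eq T.continuous (continuous_const_smul μ)
    exact this.completeSpace_coe
  choose w B hB using fun μ => exists_hilbertBasis ℝ (V μ)
  let v : (Σ μ, w μ) → H := fun a => (B a.1 a.2 : V a.1)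
  have hv : Orthonormal ℝ v :=
    hs.orthogonalFamily_eigenspaces.orthonormal_sigma_orthonormal fun μ => (B μ).orthonormal
  have hbot : (Submodule.span ℝ (Set.range v))ᗮ = ⊥ := by
    rw [eq_bot_iff]
    have key := ContinuousLinearMap.orthogonalComplement_iSup_eigenspaces_eq_bot hT hs
    rw [← key]
    intro x hx
    rw [Submodule.mem_orthogonal] at hx
    rw [← Submodule.iInf_orthogonal, Submodule.mem_iInf]
    intro μ
    rw [Submodule.mem_orthogonal]
    intro u hu
    have h3 := ((B μ).hasSum_repr ⟨u, hu⟩).mapL ((innerSL ℝ x).comp (V μ).subtypeL)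
    have h4 : ∀ i, inner ℝ x ((B μ i : V μ) : H) = 0 := fun i => by
      rw [real_inner_comm]
      exact hx _ (Submodule.subset_span ⟨⟨μ, i⟩, rfl⟩)
    have h6 : (fun i => ((innerSL ℝ x).comp (V μ).subtypeL) ((B μ).repr ⟨u, hu⟩ i • B μ i)) =
        fun _ => 0 := by
      funext i
      simp [h4]
    rw [h6] at h3
    rw [real_inner_comm]
    simpa using h3.unique hasSum_zero
  refine ⟨_, HilbertBasis.mkOfOrthogonalEqBot hv hbot, fun a => a.1, fun a => ?_⟩
  rw [HilbertBasis.coe_mkOfOrthogonalEqBot]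
  exact (hVmem _ _).1 (B a.1 a.2 : V a.1).2

end Spectral

namespace TripleOperator

variable (A : TripleOperator)

/-- An operator `A` as above has an orthonormal basis of eigenvectors. -/
theorem exists_eigenbasis : ∃ (ι : Type) (b : HilbertBasis ι ℝ RealL2) (l : ι → ℝ),
    ∀ i, ∃ h : b i ∈ A.op.domain, A.op ⟨b i, h⟩ = l i • b i := by
  obtain ⟨K, hr, -, ι₀, b₀, hb₀⟩ := A.hilbertSchmidt_inverse
  have hsymm : (K : RealL2 →ₗ[ℝ] RealL2).IsSymmetric := by
    intro x y
    obtain ⟨hx, hx'⟩ := hr x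
    obtain ⟨hy, hy'⟩ := hr y
    have hf := LinearPMap.adjoint_isFormalAdjoint A.selfAdjoint.dense_domain
    rw [LinearPMap.isSelfAdjoint_def.1 A.selfAdjoint] at hf
    have := hf ⟨K x, hx⟩ ⟨K y, hy⟩
    rw [hx', hy'] at this
    exact this.symm
  obtain ⟨ι, b, c, hb⟩ :=
    exists_hilbertBasis_eigenvectors K (isCompactOperator_of_summable b₀ K hb₀) hsymm
  refine ⟨ι, b, fun i => (c i)⁻¹, fun i => ?_⟩
  obtain ⟨h, h'⟩ := hr (b i)
  have hc : c i ≠ 0 := by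
    intro h0
    have hK : K (b i) = 0 := by rw [hb, h0, zero_smul]
    have : (⟨K (b i), h⟩ : A.op.domain) = 0 := Subtype.ext hK
    rw [this, LinearPMap.map_zero] at h'
    exact b.orthonormal.ne_zero i h'.symm
  have hbi : b i = (c i)⁻¹ • K (b i) := by rw [hb, smul_smul, inv_mul_cancel₀ hc, one_smul]
  have hmem : b i ∈ A.op.domain := by rw [hbi]; exact A.op.domain.smul_mem _ h
  refine ⟨hmem, ?_⟩
  have : (⟨b i, hmem⟩ : A.op.domain) = (c i)⁻¹ • ⟨K (b i), h⟩ := Subtype.ext hbi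
  rw [this, LinearPMap.map_smul, h']

/-- The index set of the eigenbasis of `A`. -/
def Idx : Type := A.exists_eigenbasis.choose

/-- An orthonormal basis `(e_j)` of `L²(ℝ, dt)` of eigenvectors of `A`. -/
def eigenbasis : HilbertBasis A.Idx ℝ RealL2 := A.exists_eigenbasis.choose_spec.choose

/-- The eigenvalues `λ_j` of `A`, `A e_j = λ_j e_j`. -/
def eigenvalue : A.Idx → ℝ := A.exists_eigenbasis.choose_spec.choose_spec.choose

theorem op_eigenbasis (j : A.Idx) : ∃ h : A.eigenbasis j ∈ A.op.domain,
    A.op ⟨A.eigenbasis j, h⟩ = A.eigenvalue j • A.eigenbasis j :=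
  A.exists_eigenbasis.choose_spec.choose_spec.choose_spec j

/-- The basis vector `e_j`, as an element of `L²(ℝ, ℂ, dt)`. -/
def eigenvec (j : A.Idx) : ComplexL2 := Complex.ofRealCLM.compLp (A.eigenbasis j)

end TripleOperator

/-! ### The space `E_ℂ` -/

/-- The canonical `ℂ`-bilinear form `⟨ξ, η⟩ = ∫ ξ η dt` on `L²(ℝ, ℂ, dt)`, as a continuous linear
form in `η`. -/
def bilin (ξ : ComplexL2) : ComplexL2 →L[ℂ] ℂ := innerSL ℂ (star ξ)

theorem bilin_apply (ξ η : ComplexL2) : bilin ξ η = ∫ t, ξ t * η t := by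
  simp only [bilin, innerSL_apply_apply, L2.inner_def]
  refine integral_congr_ae ?_
  filter_upwards [Lp.coeFn_star ξ] with t ht
  simp [ht, mul_comm]

variable (A : TripleOperator)

/-- `|ξ|_p² = |A^p ξ|_0² = ∑_j λ_j^{2p} |⟨ξ, e_j⟩|²`, for `p ∈ ℝ`. -/
def vecNormSq (p : ℝ) (ξ : ComplexL2) : ℝ≥0∞ :=
  ∑' j, ENNReal.ofReal (A.eigenvalue j ^ (2 * p)) * ‖bilin ξ (A.eigenvec j)‖ₑ ^ 2

/-- `E_ℂ`, the complexification of `E = ⋂_p D(A^p)`. -/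
def EC : Set ComplexL2 := {ξ | ∀ p : ℝ, vecNormSq A p ξ < ∞}

/-! ### The space of test functions `(E)_β` -/

/-- A Hilbert-Schmidt tensor `f` of order `n` over `L²(ℝ, ℂ, dt)` is given by the continuous
`n`-linear form `(x₁, …, xₙ) ↦ ⟨f, x₁ ⊗ ⋯ ⊗ xₙ⟩`. -/
abbrev Tensor (n : ℕ) : Type := ContinuousMultilinearMap ℂ (fun _ : Fin n => ComplexL2) ℂ

/-- `|f|_p² = |(A^{⊗n})^p f|_0² = ∑_J λ_{J₁}^{2p} ⋯ λ_{Jₙ}^{2p} |⟨f, e_{J₁} ⊗ ⋯ ⊗ e_{Jₙ}⟩|²`. -/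
def tensorNormSq (p : ℝ) {n : ℕ} (f : Tensor n) : ℝ≥0∞ :=
  ∑' J : Fin n → A.Idx, (∏ i, ENNReal.ofReal (A.eigenvalue (J i) ^ (2 * p))) *
    ‖f fun i => A.eigenvec (J i)‖ₑ ^ 2

/-- `|Φ|_{p,β} = (∑ₙ (n!)^{1+β} |fₙ|_p²)^{1/2}` for `Φ ∼ (fₙ)`. -/
def fockNorm (β p : ℝ) (f : ∀ n, Tensor n) : ℝ≥0∞ :=
  (∑' n, ENNReal.ofReal ((n.factorial : ℝ) ^ (1 + β)) * tensorNormSq A p (f n)) ^ (1 / 2 : ℝ)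

theorem fockNorm_eq_lintegral (β p : ℝ) (f : ∀ n, Tensor n) :
    letI : MeasurableSpace (Σ n, Fin n → A.Idx) := ⊤
    fockNorm A β p f = (∫⁻ a, ((ENNReal.ofReal ((a.1.factorial : ℝ) ^ (1 + β)) *
      ∏ i, ENNReal.ofReal (A.eigenvalue (a.2 i) ^ (2 * p))) ^ (1 / 2 : ℝ) *
      ‖f a.1 fun i => A.eigenvec (a.2 i)‖ₑ) ^ (2 : ℝ)
        ∂(Measure.count : Measure (Σ n, Fin n → A.Idx))) ^ (1 / 2 : ℝ) := by
  let _ : MeasurableSpace (Σ n, Fin n → A.Idx) := ⊤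
  have : MeasurableSingletonClass (Σ n, Fin n → A.Idx) := ⟨fun _ => trivial⟩
  rw [lintegral_count, ENNReal.tsum_sigma']
  simp only [fockNorm, tensorNormSq, ← ENNReal.tsum_mul_left]
  congr 1
  refine tsum_congr fun n => tsum_congr fun J => ?_
  rw [ENNReal.mul_rpow_of_nonneg _ _ (by norm_num), ← ENNReal.rpow_mul]
  norm_num [mul_assoc]

theorem fockNorm_add_le (β p : ℝ) (f g : ∀ n, Tensor n) :
    fockNorm A β p (f + g) ≤ fockNorm A β p f + fockNorm A β p g := by
  let _ : MeasurableSpace (Σ n, Fin n → A.Idx) := ⊤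
  simp only [fockNorm_eq_lintegral]
  refine le_trans ?_ (ENNReal.lintegral_Lp_add_le (p := 2) (μ := Measure.count)
    measurable_from_top.aemeasurable measurable_from_top.aemeasurable (by norm_num))
  gcongr with a
  simp only [Pi.add_apply, add_apply, ← mul_add]
  gcongr
  exact enorm_add_le _ _

theorem fockNorm_smul (β p : ℝ) (c : ℂ) (f : ∀ n, Tensor n) :
    fockNorm A β p (c • f) = ‖c‖ₑ * fockNorm A β p f := by
  have h : ‖c‖ₑ = (‖c‖ₑ ^ 2) ^ (1 / 2 : ℝ) := by
    rw [← ENNReal.rpow_natCast, ← ENNReal.rpow_mul]; norm_num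
  rw [h, fockNorm, fockNorm, ← ENNReal.mul_rpow_of_nonneg _ _ (by norm_num), ← ENNReal.tsum_mul_left]
  congr 1
  refine tsum_congr fun n => ?_
  rw [tensorNormSq, tensorNormSq, mul_left_comm, ← ENNReal.tsum_mul_left (a := ‖c‖ₑ ^ 2)]
  congr 1
  refine tsum_congr fun J => ?_
  simp only [Pi.smul_apply, smul_apply, smul_eq_mul, enorm_mul, mul_pow]
  ring

/-- The space `(E)_β`, given through the Wiener-Itô chaos decomposition: the sequences `(fₙ)` of
symmetric tensors such that `|(fₙ)|_{p,β} < ∞` for all `p ∈ ℝ`. -/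
def testSubmodule (β : ℝ) : Submodule ℂ (∀ n, Tensor n) where
  carrier := {f | (∀ n (σ : Equiv.Perm (Fin n)) (x : Fin n → ComplexL2), f n (x ∘ σ) = f n x) ∧
    ∀ p : ℝ, fockNorm A β p f < ∞}
  add_mem' := by
    rintro f g ⟨hf, hf'⟩ ⟨hg, hg'⟩
    refine ⟨fun n σ x => ?_, fun p => (fockNorm_add_le A β p f g).trans_lt
      (ENNReal.add_lt_top.2 ⟨hf' p, hg' p⟩)⟩
    simp only [Pi.add_apply, add_apply, hf n σ x, hg n σ x]
  zero_mem' := by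
    refine ⟨fun n σ x => rfl, fun p => ?_⟩
    simp [fockNorm, tensorNormSq]
  smul_mem' := by
    rintro c f ⟨hf, hf'⟩
    refine ⟨fun n σ x => ?_, fun p => ?_⟩
    · simp only [Pi.smul_apply, smul_apply, hf n σ x]
    · rw [fockNorm_smul]
      exact ENNReal.mul_lt_top enorm_lt_top (hf' p)

/-- The space `(E)_β`, as a type of its own (it does not carry the topology of the product). -/
def TestSpace (β : ℝ) : Type := testSubmodule A β

instance (β : ℝ) : AddCommGroup (TestSpace A β) := inferInstanceAs (AddCommGroup (testSubmodule A β))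

instance (β : ℝ) : Module ℂ (TestSpace A β) := inferInstanceAs (Module ℂ (testSubmodule A β))

/-- The norm `|·|_{p,β}` on `(E)_β`. -/
def testNorm (β p : ℝ) : Seminorm ℂ (TestSpace A β) :=
  Seminorm.of (fun f => (fockNorm A β p f.1).toReal)
    (fun f g => by
      rw [← ENNReal.toReal_add (f.2.2 p).ne (g.2.2 p).ne]
      exact ENNReal.toReal_mono (ENNReal.add_ne_top.2 ⟨(f.2.2 p).ne, (g.2.2 p).ne⟩)
        (fockNorm_add_le A β p f.1 g.1))
    (fun c f => by
      change (fockNorm A β p (c • f.1)).toReal = _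
      rw [fockNorm_smul, ENNReal.toReal_mul, toReal_enorm])

/-- The family of norms `|·|_{p,β}`, `p ∈ ℝ`. -/
def testNorms (β : ℝ) : SeminormFamily ℂ (TestSpace A β) ℝ := testNorm A β

/-- The topology of `(E)_β`: the projective limit topology, defined by the norms `|·|_{p,β}`. -/
instance testTopology (β : ℝ) : TopologicalSpace (TestSpace A β) :=
  (testNorms A β).moduleFilterBasis.topology

theorem testSpace_withSeminorms (β : ℝ) : WithSeminorms (testNorms A β) := ⟨rfl⟩

instance (β : ℝ) : IsTopologicalAddGroup (TestSpace A β) :=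
  (testSpace_withSeminorms A β).topologicalAddGroup

instance (β : ℝ) : ContinuousSMul ℂ (TestSpace A β) :=
  (testSpace_withSeminorms A β).continuousSMul

/-- The space `(E)_β*` of generalized functions: the dual of `(E)_β` with the strong topology. -/
abbrev Distributions (β : ℝ) : Type := StrongDual ℂ (TestSpace A β)

/-! ### Exponential vectors, `S`-transform, Wick product -/

/-- The chaos decomposition `(ξ^{⊗n} / n!)ₙ` of the exponential vector `Φ_ξ`. -/
def expCoeff (ξ : ComplexL2) (n : ℕ) : Tensor n :=
  (n.factorial : ℂ)⁻¹ •
    (ContinuousMultilinearMap.mkPiAlgebra ℂ (Fin n) ℂ).compContinuousLinearMap fun _ => bilin ξ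

theorem expCoeff_apply (ξ : ComplexL2) (n : ℕ) (x : Fin n → ComplexL2) :
    expCoeff ξ n x = (n.factorial : ℂ)⁻¹ * ∏ i, bilin ξ (x i) := by
  simp [expCoeff]

theorem tsum_prod_pi {ι : Type} (a : ι → ℝ≥0∞) (n : ℕ) :
    ∑' J : Fin n → ι, ∏ i, a (J i) = (∑' j, a j) ^ n := by
  induction n with
  | zero => simp
  | succ n ih =>
    rw [← (Fin.consEquiv fun _ : Fin (n + 1) => ι).tsum_eq, ENNReal.tsum_prod', pow_succ',
      ← ENNReal.tsum_mul_right]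
    refine tsum_congr fun j => ?_
    rw [← ih, ← ENNReal.tsum_mul_left]
    refine tsum_congr fun J => ?_
    simp [Fin.prod_univ_succ, Fin.consEquiv]

theorem tensorNormSq_expCoeff (p : ℝ) (ξ : ComplexL2) (n : ℕ) :
    tensorNormSq A p (expCoeff ξ n) =
      ‖(n.factorial : ℂ)⁻¹‖ₑ ^ 2 * vecNormSq A p ξ ^ n := by
  rw [vecNormSq, ← tsum_prod_pi, tensorNormSq, ← ENNReal.tsum_mul_left]
  refine tsum_congr fun J => ?_
  have h : ‖∏ i, bilin ξ (A.eigenvec (J i))‖ₑ = ∏ i, ‖bilin ξ (A.eigenvec (J i))‖ₑ := by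
    simp only [← ofReal_norm, norm_prod]
    exact ENNReal.ofReal_prod_of_nonneg fun i _ => norm_nonneg _
  rw [expCoeff_apply, enorm_mul, mul_pow, Finset.prod_mul_distrib, Finset.prod_pow, h]
  ring

theorem summable_pow_mul_factorial_rpow {β : ℝ} (hβ : β < 1) (r : ℝ) (hr : 0 ≤ r) :
    Summable fun n : ℕ => r ^ n * (n.factorial : ℝ) ^ (β - 1) := by
  rcases hr.eq_or_lt with rfl | hr
  · refine summable_of_ne_finset_zero (s := {0}) fun n hn => ?_
    simp [show n ≠ 0 by simpa using hn]
  refine summable_of_ratio_test_tendsto_lt_one (l := 0) one_pos ?_ ?_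
  · exact Filter.Eventually.of_forall fun n => by positivity
  · have h1 : Filter.Tendsto (fun n : ℕ => r * ((n : ℝ) + 1) ^ (-(1 - β))) Filter.atTop
        (nhds (r * 0)) :=
      ((tendsto_rpow_neg_atTop (sub_pos.2 hβ)).comp
        (Filter.tendsto_atTop_add_const_right _ _ tendsto_natCast_atTop_atTop)).const_mul r
    rw [mul_zero] at h1
    refine h1.congr fun n => ?_
    have hn : (0 : ℝ) < n.factorial := by positivity
    have h2 : (0 : ℝ) < (n.factorial : ℝ) ^ (β - 1) := by positivity
    rw [Real.norm_of_nonneg (by positivity), Real.norm_of_nonneg (by positivity),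
      Nat.factorial_succ, Nat.cast_mul, Real.mul_rpow (by positivity) hn.le, pow_succ, neg_sub]
    push_cast
    field_simp

theorem expCoeff_mem {β : ℝ} (hβ : β < 1) {ξ : ComplexL2} (hξ : ξ ∈ EC A) :
    expCoeff ξ ∈ testSubmodule A β := by
  refine ⟨fun n σ x => ?_, fun p => ?_⟩
  · simp only [expCoeff_apply, Function.comp_apply]
    rw [Equiv.prod_comp σ fun i => bilin ξ (x i)]
  · refine ENNReal.rpow_lt_top_of_nonneg (by norm_num) ?_
    have hs := summable_pow_mul_factorial_rpow hβ (vecNormSq A p ξ).toReal ENNReal.toReal_nonneg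
    refine (lt_of_le_of_lt (le_of_eq ?_) hs.tsum_ofReal_lt_top).ne
    refine tsum_congr fun n => ?_
    have hn : (0 : ℝ) < n.factorial := by positivity
    rw [tensorNormSq_expCoeff, ← ofReal_norm, ← ENNReal.ofReal_pow (norm_nonneg _), ← mul_assoc,
      ← ENNReal.ofReal_mul (by positivity), mul_comm,
      ENNReal.ofReal_mul (p := (vecNormSq A p ξ).toReal ^ n) (by positivity),
      ENNReal.ofReal_pow ENNReal.toReal_nonneg, ENNReal.ofReal_toReal (hξ p).ne]
    congr 2
    rw [norm_inv, Complex.norm_natCast, ← Real.rpow_natCast, ← Real.rpow_neg_one,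
      ← Real.rpow_mul hn.le, ← Real.rpow_add hn]
    congr 1
    push_cast
    ring

/-- The exponential vector `Φ_ξ ∈ (E)_β`, for `ξ ∈ E_ℂ`. -/
def expVector {β : ℝ} (hβ : β < 1) (ξ : EC A) : TestSpace A β :=
  ⟨expCoeff ξ, expCoeff_mem A hβ ξ.2⟩

/-- The `S`-transform `S(Ψ)(ξ) = ⟪Ψ, Φ_ξ⟫`. -/
def sTransform {β : ℝ} (hβ : β < 1) (Ψ : Distributions A β) (ξ : EC A) : ℂ :=
  Ψ (expVector A hβ ξ)

/-- The Wick product `Ψ ⋄ Θ = S⁻¹(S(Ψ) S(Θ))`. -/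
def wick {β : ℝ} (hβ : β < 1) (Ψ Θ : Distributions A β) : Distributions A β :=
  Function.invFun (sTransform A hβ) fun ξ => sTransform A hβ Ψ ξ * sTransform A hβ Θ ξ

end WhiteNoise

end

noncomputable section

namespace WhiteNoise

/-! ### Eigenvalues and eigenvectors -/

namespace TripleOperator

variable (A : TripleOperator)

/-! In an eigenbasis of `A`, a symmetric tensor is a function on multisets of basis indices, and
`(E)_β` becomes a space of rapidly decreasing sequences. Because `∑ λ_j^{-2s} ≤ 1/2` for some `s`
(from the Hilbert–Schmidt inverse and `inf σ(A) > 1`), the Hilbert norms may be replaced by the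
weighted sup norms `sup_α weight p α * ‖coord f α‖`, at the cost of a fixed shift of `p` and a
factor 2 (`weight_mul_coord_le`, `testNorm_le_of_weight_le`).

The operator `C_φ` is defined directly, without using the Wick product: its coordinate at `γ` is `φ
(shift γ f)`, where `shift γ` is a normalized derivative. The estimate `weight_mul_shift_le` makes
`shift γ f` decay in `γ` at any prescribed rate, so `C_φ f` is again a test function although `φ`
has finite order; applied to bounded sets, the same estimate gives continuity of `φ ↦ C_φ`.

Exponential vectors are eigenvectors of every `shift γ`, hence of `C_φ`, with eigenvalue `S(φ)(ξ)`
(`conv_expVector`). Therefore `ψ ∘ C_φ` has `S`-transform `S(φ) S(ψ)`. Since `S` is injective (a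
power series that vanishes at all finitely supported points has zero coefficients), this functional
is the Wick product, and multiplicativity of `C` reduces to commutativity and associativity of the
product of functions. Finally `φ f = (C_φ f)₀`, so composition with the vacuum functional is a
continuous left inverse of `C`. -/

theorem eigenvalue_mem_opSpectrum (j : A.Idx) : A.eigenvalue j ∈ opSpectrum A.op := by
  obtain ⟨h, h'⟩ := A.op_eigenbasis j
  intro hb
  have : (⟨A.eigenbasis j, h⟩ : A.op.domain) = 0 := by
    apply hb.injective
    simp [h']
  exact A.eigenbasis.orthonormal.ne_zero j (congrArg Subtype.val this)

theorem exists_one_lt_le_eigenvalue : ∃ ρ : ℝ, 1 < ρ ∧ ∀ j, ρ ≤ A.eigenvalue j := by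
  refine ⟨_, A.one_lt_inf_spectrum, fun j => csInf_le ?_ (A.eigenvalue_mem_opSpectrum j)⟩
  -- `sInf` of a set that is not bounded below is `0` by convention, which the assumption `1 < sInf`
  -- excludes.
  by_contra h
  have := A.one_lt_inf_spectrum
  rw [Real.sInf_of_not_bddBelow h] at this
  linarith

theorem one_lt_eigenvalue (j : A.Idx) : 1 < A.eigenvalue j := by
  obtain ⟨ρ, h, h'⟩ := A.exists_one_lt_le_eigenvalue
  exact h.trans_le (h' j)

theorem eigenvalue_pos (j : A.Idx) : 0 < A.eigenvalue j :=
  zero_lt_one.trans (A.one_lt_eigenvalue j)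

theorem tsum_enorm_inner_sq {ι H : Type} [NormedAddCommGroup H] [InnerProductSpace ℝ H]
    (b : HilbertBasis ι ℝ H) (x : H) : ∑' i, ‖inner ℝ (b i) x‖ₑ ^ 2 = ‖x‖ₑ ^ 2 := by
  have h := b.hasSum_inner_mul_inner x x
  rw [real_inner_self_eq_norm_sq] at h
  have h2 : ∀ i, inner ℝ x (b i) * inner ℝ (b i) x = ‖inner ℝ (b i) x‖ ^ 2 := fun i => by
    rw [real_inner_comm, Real.norm_eq_abs, sq_abs, sq]
  simp only [h2] at h
  simp only [← ofReal_norm, ← ENNReal.ofReal_pow (norm_nonneg _)]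
  rw [← h.tsum_eq, ENNReal.ofReal_tsum_of_nonneg (fun i => by positivity) h.summable]

/-- The sum is the squared Hilbert–Schmidt norm of `K = A⁻¹` in the eigenbasis. It does not depend
on the basis: expand `K e_j` in `b₀` by Parseval, swap the sums, and use that `K` is self-adjoint.
-/
theorem tsum_eigenvalue_inv_sq_lt_top :
    ∑' j, ENNReal.ofReal (A.eigenvalue j ^ (-2 : ℝ)) < ∞ := by
  obtain ⟨K, hr, hl, ι₀, b₀, hb₀⟩ := A.hilbertSchmidt_inverse
  have hK : ∀ j, K (A.eigenbasis j) = (A.eigenvalue j)⁻¹ • A.eigenbasis j := fun j => by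
    obtain ⟨h, h'⟩ := A.op_eigenbasis j
    have h2 := hl ⟨_, h⟩
    rw [h', map_smul] at h2
    simp only at h2
    rw [eq_inv_smul_iff₀ (A.eigenvalue_pos j).ne']
    exact h2
  have h1 : ∀ j, ENNReal.ofReal (A.eigenvalue j ^ (-2 : ℝ)) = ‖K (A.eigenbasis j)‖ₑ ^ 2 := by
    intro j
    have hj := A.eigenvalue_pos j
    rw [hK, ← ofReal_norm, ← ENNReal.ofReal_pow (norm_nonneg _), norm_smul,
      A.eigenbasis.orthonormal.1 j, mul_one, Real.norm_of_nonneg (by positivity),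
      Real.rpow_neg hj.le, inv_pow]
    norm_num
  have h2 : ∀ j i, inner ℝ (b₀ i) (K (A.eigenbasis j)) =
      inner ℝ (A.eigenbasis j) (K.adjoint (b₀ i)) := fun j i => by
    rw [ContinuousLinearMap.adjoint_inner_right, real_inner_comm]
  have hsymm : ∀ x y, inner ℝ (K x) y = inner ℝ x (K y) := by
    intro x y
    obtain ⟨hx, hx'⟩ := hr x
    obtain ⟨hy, hy'⟩ := hr y
    have hf := LinearPMap.adjoint_isFormalAdjoint A.selfAdjoint.dense_domain
    rw [LinearPMap.isSelfAdjoint_def.1 A.selfAdjoint] at hf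
    have := hf ⟨K x, hx⟩ ⟨K y, hy⟩
    rw [hx', hy'] at this
    exact this.symm
  have hadj : K.adjoint = K :=
    ((ContinuousLinearMap.eq_adjoint_iff _ _).2 hsymm).symm
  simp only [h1, ← tsum_enorm_inner_sq b₀, h2]
  rw [ENNReal.tsum_comm]
  simp only [tsum_enorm_inner_sq, hadj]
  refine lt_of_le_of_lt (le_of_eq (tsum_congr fun i => ?_)) hb₀.tsum_ofReal_lt_top
  rw [← ofReal_norm, ENNReal.ofReal_pow (norm_nonneg _)]

theorem exists_tsum_eigenvalue_le : ∃ s : ℝ,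
    ∑' j, ENNReal.ofReal (A.eigenvalue j ^ (-(2 * s))) ≤ 2⁻¹ := by
  obtain ⟨ρ, hρ, hρ'⟩ := A.exists_one_lt_le_eigenvalue
  have hfin := A.tsum_eigenvalue_inv_sq_lt_top
  set S := ∑' j, ENNReal.ofReal (A.eigenvalue j ^ (-2 : ℝ)) with hS
  obtain ⟨n, hn⟩ := pow_unbounded_of_one_lt (2 * S.toReal) hρ
  have hρ0 : (0 : ℝ) < ρ ^ n := by positivity
  -- With this exponent `λ_j^{-2s} = λ_j^{-n} λ_j^{-2} ≤ ρ^{-n} λ_j^{-2}`, and `n` was chosen so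
  -- that `ρ^n > 2S`.
  refine ⟨1 + n / 2, ?_⟩
  have h1 : ∀ j, ENNReal.ofReal (A.eigenvalue j ^ (-(2 * (1 + n / 2 : ℝ)))) ≤
      ENNReal.ofReal (ρ ^ n)⁻¹ * ENNReal.ofReal (A.eigenvalue j ^ (-2 : ℝ)) := fun j => by
    have hj := A.eigenvalue_pos j
    rw [← ENNReal.ofReal_mul (by positivity)]
    refine ENNReal.ofReal_le_ofReal ?_
    rw [show -(2 * (1 + n / 2 : ℝ)) = -n + -2 by ring, Real.rpow_add hj, Real.rpow_neg hj.le,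
      Real.rpow_natCast]
    gcongr
    exact hρ' j
  refine (ENNReal.tsum_le_tsum h1).trans ?_
  rw [ENNReal.tsum_mul_left, ← hS, ← ENNReal.ofReal_toReal hfin.ne,
    ← ENNReal.ofReal_mul (by positivity), show (2⁻¹ : ℝ≥0∞) = ENNReal.ofReal 2⁻¹ by
      rw [ENNReal.ofReal_inv_of_pos two_pos]; simp]
  refine ENNReal.ofReal_le_ofReal ?_
  rw [inv_mul_le_iff₀ hρ0]
  linarith

theorem star_eigenvec (j : A.Idx) : star (A.eigenvec j) = A.eigenvec j := by
  refine Lp.ext ?_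
  filter_upwards [Lp.coeFn_star (A.eigenvec j),
    Complex.ofRealCLM.coeFn_compLp (A.eigenbasis j)] with t h1 h2
  rw [h1, Pi.star_apply, eigenvec, h2]
  simp

theorem bilin_eigenvec [DecidableEq A.Idx] (i j : A.Idx) :
    bilin (A.eigenvec i) (A.eigenvec j) = if i = j then 1 else 0 := by
  have h := orthonormal_iff_ite.1 A.eigenbasis.orthonormal i j
  rw [L2.inner_def] at h
  rw [bilin_apply]
  have h2 : (fun t => A.eigenvec i t * A.eigenvec j t) =ᵐ[volume]
      fun t => ((inner ℝ (A.eigenbasis i t) (A.eigenbasis j t) : ℝ) : ℂ) := by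
    filter_upwards [Complex.ofRealCLM.coeFn_compLp (A.eigenbasis i),
      Complex.ofRealCLM.coeFn_compLp (A.eigenbasis j)] with t h1 h2
    rw [eigenvec, eigenvec, h1, h2]
    simp [mul_comm]
  rw [integral_congr_ae h2, integral_complex_ofReal, h]
  split_ifs <;> simp

theorem norm_bilin_eigenvec (j : A.Idx) : ‖bilin (A.eigenvec j)‖ = 1 := by
  classical
  have h := A.bilin_eigenvec j j
  rw [bilin, innerSL_apply_apply, A.star_eigenvec, if_pos rfl, inner_self_eq_norm_sq_to_K] at h
  rw [bilin, innerSL_apply_norm, A.star_eigenvec]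
  have h' : ‖A.eigenvec j‖ ^ 2 = 1 := by simpa using congrArg norm h
  exact (pow_eq_one_iff_of_nonneg (norm_nonneg _) two_ne_zero).1 h'

/-- The real eigenbasis spans a dense subspace of the real space; splitting into real and imaginary
parts transfers this to the complexification. -/
theorem dense_span_eigenvec :
    Dense (Submodule.span ℂ (Set.range A.eigenvec) : Set ComplexL2) := by
  let L := Complex.ofRealCLM.compLpL 2 (volume : Measure ℝ)
  let V := (Submodule.span ℂ (Set.range A.eigenvec)).topologicalClosure
  have hL : ∀ x : RealL2, L x ∈ V := by
    intro x
    have hx : x ∈ (Submodule.span ℝ (Set.range A.eigenbasis)).topologicalClosure := by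
      rw [A.eigenbasis.dense_span]; trivial
    have h1 : L x ∈ closure (L '' (Submodule.span ℝ (Set.range A.eigenbasis) : Set RealL2)) :=
      image_closure_subset_closure_image L.continuous ⟨x, hx, rfl⟩
    refine closure_mono ?_ h1
    rintro _ ⟨y, hy, rfl⟩
    have : Submodule.span ℝ (Set.range A.eigenbasis) ≤
        ((Submodule.span ℂ (Set.range A.eigenvec)).restrictScalars ℝ).comap L.toLinearMap := by
      rw [Submodule.span_le]
      rintro _ ⟨j, rfl⟩
      exact Submodule.subset_span ⟨j, rfl⟩
    exact this hy
  intro x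
  have hx : x = L (Complex.reCLM.compLp x) + Complex.I • L (Complex.imCLM.compLp x) := by
    refine Lp.ext ?_
    filter_upwards [
      Lp.coeFn_add (L (Complex.reCLM.compLp x)) (Complex.I • L (Complex.imCLM.compLp x)),
      Lp.coeFn_smul Complex.I (L (Complex.imCLM.compLp x)),
      Complex.ofRealCLM.coeFn_compLp (Complex.reCLM.compLp x),
      Complex.ofRealCLM.coeFn_compLp (Complex.imCLM.compLp x),
      Complex.reCLM.coeFn_compLp x, Complex.imCLM.coeFn_compLp x] with t h1 h2 h3 h4 h5 h6
    rw [h1, Pi.add_apply, h2, Pi.smul_apply]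
    change _ = (Complex.ofRealCLM.compLp (Complex.reCLM.compLp x)) t +
      Complex.I • (Complex.ofRealCLM.compLp (Complex.imCLM.compLp x)) t
    rw [h3, h4, h5, h6]
    simp [mul_comm Complex.I]
  have : x ∈ V := by
    rw [hx]
    exact V.add_mem (hL _) (V.smul_mem _ (hL _))
  exact this

/-- A continuous multilinear form is determined by its values at the eigenvectors. -/
theorem tensor_ext {n : ℕ} {f g : Tensor n}
    (h : ∀ J : Fin n → A.Idx, (f fun i => A.eigenvec (J i)) = g fun i => A.eigenvec (J i)) :
    f = g := by
  classical
  -- `s` is the set of slots whose entries are arbitrary. Freeing one more slot uses that a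
  -- continuous linear form is determined on the dense span of the eigenvectors.
  have key : ∀ s : Finset (Fin n), ∀ x : Fin n → ComplexL2,
      (∀ i, i ∉ s → x i ∈ Set.range A.eigenvec) → f x = g x := by
    intro s
    induction s using Finset.induction_on with
    | empty =>
      intro x hx
      choose J hJ using fun i => hx i (by simp)
      rw [← funext hJ]
      exact h J
    | insert a s ha ih =>
      intro x hx
      let F : ComplexL2 →L[ℂ] ℂ := f.toContinuousLinearMap x a
      let G : ComplexL2 →L[ℂ] ℂ := g.toContinuousLinearMap x a
      have hFG : F = G := by
        refine ContinuousLinearMap.ext_on A.dense_span_eigenvec ?_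
        rintro _ ⟨j, rfl⟩
        refine ih _ fun i hi => ?_
        by_cases hia : i = a
        · subst hia; simp
        · rw [Function.update_of_ne hia]
          exact hx i (by simp [hia, hi])
      have := DFunLike.congr_fun hFG (x a)
      simpa [F, G] using this
  exact ContinuousMultilinearMap.ext fun x => key Finset.univ x (by simp)

end TripleOperator

/-! ### Coordinates with respect to the eigenbasis -/

/-- The multiset of values of a tuple. -/
def tupleMultiset {ι : Type} {n : ℕ} (J : Fin n → ι) : Multiset ι := Finset.univ.val.map J

@[simp]
theorem card_tupleMultiset {ι : Type} {n : ℕ} (J : Fin n → ι) :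
    Multiset.card (tupleMultiset J) = n := by
  simp [tupleMultiset]

theorem prod_map_tupleMultiset {ι M : Type} [CommMonoid M] {n : ℕ} (J : Fin n → ι) (g : ι → M) :
    ((tupleMultiset J).map g).prod = ∏ i, g (J i) := by
  rw [tupleMultiset, Multiset.map_map]
  rfl

theorem tupleMultiset_comp_perm {ι : Type} {n : ℕ} (J : Fin n → ι) (σ : Equiv.Perm (Fin n)) :
    tupleMultiset (J ∘ σ) = tupleMultiset J := by
  rw [tupleMultiset, ← Multiset.map_map, Multiset.map_univ_val_equiv, tupleMultiset]

theorem tupleMultiset_get {ι : Type} (α : Multiset ι) :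
    tupleMultiset (fun i => α.toList.get i) = α := by
  rw [tupleMultiset, Fin.univ_val_map, List.ofFn_get, Multiset.coe_toList]

/-- Equal multisets mean that the fibres of `J` and `K` over each value have equal size; bijections
between the fibres glue to a permutation. -/
theorem exists_perm_of_tupleMultiset_eq {ι : Type} {n : ℕ} {J K : Fin n → ι}
    (h : tupleMultiset J = tupleMultiset K) : ∃ σ : Equiv.Perm (Fin n), J = K ∘ σ := by
  classical
  have hc : ∀ v, Fintype.card {i // J i = v} = Fintype.card {i // K i = v} := fun v => by
    have h' := congrArg (Multiset.count v) h
    simp only [tupleMultiset, Multiset.count_map] at h'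
    rw [Fintype.card_subtype, Fintype.card_subtype]
    simp only [eq_comm (a := v)] at h'
    exact h'
  let e := (Equiv.sigmaFiberEquiv J).symm.trans
    ((Equiv.sigmaCongrRight fun v => Fintype.equivOfCardEq (hc v)).trans (Equiv.sigmaFiberEquiv K))
  refine ⟨e, funext fun i => ?_⟩
  exact ((Fintype.equivOfCardEq (hc (J i))) ⟨i, rfl⟩).2.symm

/-! ### Weights, and the norms in coordinates -/

variable (A : TripleOperator)

/-- The weights `(|α|!)^{(1+β)/2} ∏_{j ∈ α} λ_j^p`. -/
def weight (β p : ℝ) (α : Multiset A.Idx) : ℝ :=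
  ((Multiset.card α).factorial : ℝ) ^ ((1 + β) / 2) * (α.map fun j => A.eigenvalue j ^ p).prod

theorem prod_eigenvalue_rpow_pos (p : ℝ) (α : Multiset A.Idx) :
    0 < (α.map fun j => A.eigenvalue j ^ p).prod := by
  induction α using Multiset.induction_on with
  | empty => simp
  | cons j α ih =>
    have := A.eigenvalue_pos j
    rw [Multiset.map_cons, Multiset.prod_cons]
    positivity

theorem prod_eigenvalue_rpow_add (p q : ℝ) (α : Multiset A.Idx) :
    (α.map fun j => A.eigenvalue j ^ (p + q)).prod =
      (α.map fun j => A.eigenvalue j ^ p).prod * (α.map fun j => A.eigenvalue j ^ q).prod := by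
  rw [← Multiset.prod_map_mul]
  simp only [Real.rpow_add (A.eigenvalue_pos _)]

theorem prod_eigenvalue_rpow_mono {p q : ℝ} (h : p ≤ q) (α : Multiset A.Idx) :
    (α.map fun j => A.eigenvalue j ^ p).prod ≤ (α.map fun j => A.eigenvalue j ^ q).prod := by
  induction α using Multiset.induction_on with
  | empty => simp
  | cons j α ih =>
    have h1 := A.eigenvalue_pos j
    have h2 := prod_eigenvalue_rpow_pos A p α
    simp only [Multiset.map_cons, Multiset.prod_cons]
    gcongr
    exact (A.one_lt_eigenvalue j).le

variable {A} {β : ℝ}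

theorem weight_pos (p : ℝ) (α : Multiset A.Idx) : 0 < weight A β p α :=
  mul_pos (by positivity) (prod_eigenvalue_rpow_pos A p α)

theorem weight_mono {p q : ℝ} (h : p ≤ q) (α : Multiset A.Idx) :
    weight A β p α ≤ weight A β q α := by
  have := prod_eigenvalue_rpow_mono A h α
  unfold weight
  gcongr

theorem prod_le_weight (hβ₀ : 0 ≤ β) (p : ℝ) (α : Multiset A.Idx) :
    (α.map fun j => A.eigenvalue j ^ p).prod ≤ weight A β p α := by
  refine le_mul_of_one_le_left (prod_eigenvalue_rpow_pos A p α).le ?_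
  exact Real.one_le_rpow (by exact_mod_cast Nat.succ_le_of_lt (Nat.factorial_pos _)) (by linarith)

/-- The coordinates of a symmetric tensor, indexed by multisets of eigenvectors. -/
def coord (f : TestSpace A β) (α : Multiset A.Idx) : ℂ :=
  f.1 α.toList.length fun i => A.eigenvec (α.toList.get i)

/-- By symmetry the value depends only on the multiset of indices, so the enumeration chosen in
`coord` is immaterial. -/
theorem apply_eigenvec (f : TestSpace A β) {n : ℕ} (J : Fin n → A.Idx) :
    (f.1 n fun i => A.eigenvec (J i)) = coord f (tupleMultiset J) := by
  -- The length `m` is kept free because the length of `toList` equals `n` only propositionally.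
  have key : ∀ m (K : Fin m → A.Idx), tupleMultiset J = tupleMultiset K →
      (f.1 n fun i => A.eigenvec (J i)) = f.1 m fun i => A.eigenvec (K i) := by
    intro m K h
    obtain rfl : n = m := by simpa using congrArg Multiset.card h
    obtain ⟨σ, rfl⟩ := exists_perm_of_tupleMultiset_eq h
    exact f.2.1 n σ fun i => A.eigenvec (K i)
  exact key _ _ (tupleMultiset_get _).symm

theorem coord_injective : Function.Injective (coord : TestSpace A β → Multiset A.Idx → ℂ) := by
  intro f g h
  refine Subtype.ext (funext fun n => A.tensor_ext fun J => ?_)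
  rw [apply_eigenvec, apply_eigenvec, h]

theorem coord_add (f g : TestSpace A β) (α : Multiset A.Idx) :
    coord (f + g) α = coord f α + coord g α := rfl

theorem coord_smul (c : ℂ) (f : TestSpace A β) (α : Multiset A.Idx) :
    coord (c • f) α = c * coord f α := rfl

/-- The coordinates as linear forms. -/
def coordₗ (α : Multiset A.Idx) : TestSpace A β →ₗ[ℂ] ℂ where
  toFun f := coord f α
  map_add' f g := coord_add f g α
  map_smul' c f := coord_smul c f α

theorem weight_sq_eq {n : ℕ} (p : ℝ) (J : Fin n → A.Idx) :
    ENNReal.ofReal ((n.factorial : ℝ) ^ (1 + β)) *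
      ∏ i, ENNReal.ofReal (A.eigenvalue (J i) ^ (2 * p)) =
      ENNReal.ofReal (weight A β p (tupleMultiset J)) ^ 2 := by
  have hpos : ∀ i, 0 ≤ A.eigenvalue (J i) := fun i => (A.eigenvalue_pos _).le
  rw [weight, card_tupleMultiset, prod_map_tupleMultiset, ENNReal.ofReal_mul (by positivity),
    mul_pow, ← ENNReal.ofReal_pow (by positivity),
    ENNReal.ofReal_prod_of_nonneg fun i _ => Real.rpow_nonneg (hpos i) p, ← Finset.prod_pow]
  congr 1
  · rw [← Real.rpow_natCast, ← Real.rpow_mul (by positivity)]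
    congr 2
    push_cast
    ring
  · refine Finset.prod_congr rfl fun i _ => ?_
    rw [← ENNReal.ofReal_pow (Real.rpow_nonneg (hpos i) p), ← Real.rpow_natCast,
      ← Real.rpow_mul (hpos i), mul_comm]
    push_cast
    rfl

theorem fockNorm_eq (p : ℝ) (f : ∀ n, Tensor n) : fockNorm A β p f =
    (∑' n, ∑' J : Fin n → A.Idx, (ENNReal.ofReal (weight A β p (tupleMultiset J)) *
      ‖f n fun i => A.eigenvec (J i)‖ₑ) ^ 2) ^ (1 / 2 : ℝ) := by
  simp only [fockNorm, tensorNormSq, ← ENNReal.tsum_mul_left, mul_pow, ← weight_sq_eq, mul_assoc]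

/-- A single term of the `ℓ²` sum is at most the whole sum. The converse estimate, with a loss in
`p`, is `testNorm_le_of_weight_le`. -/
theorem weight_mul_coord_le (p : ℝ) (f : TestSpace A β) (α : Multiset A.Idx) :
    weight A β p α * ‖coord f α‖ ≤ testNorm A β p f := by
  change _ ≤ (fockNorm A β p f.1).toReal
  refine (ENNReal.ofReal_le_iff_le_toReal (f.2.2 p).ne).1 ?_
  set n := α.toList.length
  set J : Fin n → A.Idx := fun i => α.toList.get i
  have hJ : tupleMultiset J = α := tupleMultiset_get α
  rw [ENNReal.ofReal_mul (weight_pos p α).le, ofReal_norm, fockNorm_eq, one_div,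
    ENNReal.le_rpow_inv_iff two_pos]
  norm_cast
  refine le_trans ?_ (ENNReal.le_tsum n)
  refine le_trans (le_of_eq ?_) (ENNReal.le_tsum J)
  rw [apply_eigenvec, hJ]

theorem testNorm_mono {p q : ℝ} (h : p ≤ q) : testNorm A β p ≤ testNorm A β q := by
  intro f
  change (fockNorm A β p f.1).toReal ≤ (fockNorm A β q f.1).toReal
  refine ENNReal.toReal_mono (f.2.2 q).ne ?_
  rw [fockNorm_eq, fockNorm_eq]
  gcongr with n J
  exact weight_mono h _

/-! ### Comparison of the Hilbert norms with weighted sup norms -/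

variable (A)

/-- An exponent `s` with `∑_j λ_j^{-2s} ≤ 1/2`. -/
def gap : ℝ := A.exists_tsum_eigenvalue_le.choose

theorem tsum_gap_le (n : ℕ) : ∑' J : Fin n → A.Idx,
    ENNReal.ofReal (((tupleMultiset J).map fun j => A.eigenvalue j ^ (-(2 * gap A))).prod) ≤
      2⁻¹ ^ n := by
  simp only [prod_map_tupleMultiset]
  simp only [ENNReal.ofReal_prod_of_nonneg fun i _ =>
    Real.rpow_nonneg (A.eigenvalue_pos _).le _]
  rw [tsum_prod_pi fun j => ENNReal.ofReal (A.eigenvalue j ^ (-(2 * gap A)))]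
  gcongr
  exact A.exists_tsum_eigenvalue_le.choose_spec

theorem summable_prod_eigenvalue :
    Summable fun α : Multiset A.Idx => (α.map fun j => A.eigenvalue j ^ (-(2 * gap A))).prod := by
  have h1 : Summable fun a : Σ n, Fin n → A.Idx =>
      ((tupleMultiset a.2).map fun j => A.eigenvalue j ^ (-(2 * gap A))).prod := by
    have : ∑' a : Σ n, Fin n → A.Idx, ENNReal.ofReal
        (((tupleMultiset a.2).map fun j => A.eigenvalue j ^ (-(2 * gap A))).prod) ≠ ∞ := by
      rw [ENNReal.tsum_sigma']
      refine ((ENNReal.tsum_le_tsum (tsum_gap_le A)).trans_lt ?_).ne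
      rw [ENNReal.tsum_geometric]
      simp
    refine (ENNReal.summable_toReal this).congr fun a => ?_
    rw [ENNReal.toReal_ofReal (prod_eigenvalue_rpow_pos A _ _).le]
  -- Choosing one enumeration per multiset embeds the family into the summable family over all
  -- tuples.
  have hinj : Function.Injective fun α : Multiset A.Idx =>
      (⟨α.toList.length, fun i => α.toList.get i⟩ : Σ n, Fin n → A.Idx) := by
    refine Function.LeftInverse.injective (g := fun a => tupleMultiset a.2) fun α => ?_
    exact tupleMultiset_get α
  refine (h1.comp_injective hinj).congr fun α => ?_
  rw [Function.comp_apply, tupleMultiset_get]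

variable {A}

theorem weight_add_gap (p : ℝ) (α : Multiset A.Idx) : weight A β (p + gap A) α ^ 2 *
    (α.map fun j => A.eigenvalue j ^ (-(2 * gap A))).prod = weight A β p α ^ 2 := by
  have h1 := prod_eigenvalue_rpow_add A (gap A) (gap A) α
  have h2 := prod_eigenvalue_rpow_add A (2 * gap A) (-(2 * gap A)) α
  rw [← two_mul] at h1
  simp only [add_neg_cancel, Real.rpow_zero, Multiset.map_const', Multiset.prod_replicate,
    one_pow] at h2
  rw [weight, weight, prod_eigenvalue_rpow_add]
  linear_combination (((Multiset.card α).factorial : ℝ) ^ ((1 + β) / 2)) ^ 2 *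
    (α.map fun j => A.eigenvalue j ^ p).prod ^ 2 * (-h2 -
      (α.map fun j => A.eigenvalue j ^ (-(2 * gap A))).prod * h1)

/-- Raising `p` by `gap A` leaves a factor `∏ λ_j^{-2 gap}` in each squared term, and these factors
are summable over all tuples of all lengths. -/
theorem fockNorm_le_of_weight_le {p M : ℝ} (hM : 0 ≤ M) (f : ∀ n, Tensor n)
    (h : ∀ n (J : Fin n → A.Idx),
      weight A β (p + gap A) (tupleMultiset J) * ‖f n fun i => A.eigenvec (J i)‖ ≤ M) :
    fockNorm A β p f ≤ ENNReal.ofReal (2 * M) := by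
  have h1 : ∀ n (J : Fin n → A.Idx), (ENNReal.ofReal (weight A β p (tupleMultiset J)) *
      ‖f n fun i => A.eigenvec (J i)‖ₑ) ^ 2 ≤ ENNReal.ofReal (M ^ 2) * ENNReal.ofReal
        (((tupleMultiset J).map fun j => A.eigenvalue j ^ (-(2 * gap A))).prod) := fun n J => by
    have h0 := (weight_pos (β := β) (p + gap A) (tupleMultiset J)).le
    have h2 := (prod_eigenvalue_rpow_pos A (-(2 * gap A)) (tupleMultiset J)).le
    rw [mul_pow, ← ENNReal.ofReal_pow (weight_pos _ _).le, ← weight_add_gap,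
      ← ofReal_norm, ← ENNReal.ofReal_pow (norm_nonneg _), ← ENNReal.ofReal_mul (by positivity),
      ← ENNReal.ofReal_mul (by positivity)]
    refine ENNReal.ofReal_le_ofReal ?_
    rw [mul_right_comm, ← mul_pow]
    gcongr
    exact h n J
  rw [fockNorm_eq, one_div, ENNReal.rpow_inv_le_iff two_pos]
  refine (ENNReal.tsum_le_tsum fun n => (ENNReal.tsum_le_tsum (h1 n)).trans
    (le_of_eq ENNReal.tsum_mul_left)).trans ?_
  rw [ENNReal.tsum_mul_left]
  refine (mul_le_mul_right (ENNReal.tsum_le_tsum (tsum_gap_le A)) _).trans ?_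
  -- The geometric series `∑ 2⁻ⁿ` equals 2, and `2 M² ≤ (2 M)²`; the sharper constant `√2` is not
  -- needed.
  rw [ENNReal.tsum_geometric, ENNReal.one_sub_inv_two, inv_inv]
  norm_cast
  rw [← ENNReal.ofReal_pow (by positivity), show (2 : ℝ≥0∞) = ENNReal.ofReal 2 by simp,
    ← ENNReal.ofReal_mul (by positivity)]
  refine ENNReal.ofReal_le_ofReal ?_
  nlinarith

theorem testNorm_le_of_weight_le {p M : ℝ} (hM : 0 ≤ M) (f : TestSpace A β)
    (h : ∀ α, weight A β (p + gap A) α * ‖coord f α‖ ≤ M) : testNorm A β p f ≤ 2 * M := by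
  change (fockNorm A β p f.1).toReal ≤ _
  refine ENNReal.toReal_le_of_le_ofReal (by positivity)
    (fockNorm_le_of_weight_le hM f.1 fun n J => ?_)
  rw [apply_eigenvec]
  exact h _

/-! ### Test functions with given coordinates -/

/-- This gives norm convergence of the series defining `coeffTensor`, since each elementary tensor
there has norm at most one. -/
theorem summable_of_weight_le (hβ₀ : 0 ≤ β) {a : Multiset A.Idx → ℂ} {M : ℝ}
    (h : ∀ α, weight A β (2 * gap A) α * ‖a α‖ ≤ M) (n : ℕ) :
    Summable fun J : Fin n → A.Idx => ‖a (tupleMultiset J)‖ := by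
  have h1 : Summable fun J : Fin n → A.Idx =>
      M * ((tupleMultiset J).map fun j => A.eigenvalue j ^ (-(2 * gap A))).prod := by
    refine Summable.mul_left _ ?_
    refine (ENNReal.summable_toReal ((tsum_gap_le A n).trans_lt ?_).ne).congr fun a => ?_
    · exact ENNReal.pow_lt_top (by simp)
    · rw [ENNReal.toReal_ofReal (prod_eigenvalue_rpow_pos A _ _).le]
  refine Summable.of_nonneg_of_le (fun _ => norm_nonneg _) (fun J => ?_) h1
  set α := tupleMultiset J
  have h2 := prod_eigenvalue_rpow_add A (2 * gap A) (-(2 * gap A)) α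
  simp only [add_neg_cancel, Real.rpow_zero, Multiset.map_const', Multiset.prod_replicate,
    one_pow] at h2
  have h3 := prod_eigenvalue_rpow_pos A (-(2 * gap A)) α
  calc ‖a α‖ = (α.map fun j => A.eigenvalue j ^ (2 * gap A)).prod * ‖a α‖ *
      (α.map fun j => A.eigenvalue j ^ (-(2 * gap A))).prod := by
        rw [mul_right_comm, ← h2, one_mul]
    _ ≤ _ := by
      gcongr
      refine le_trans ?_ (h α)
      gcongr
      exact prod_le_weight hβ₀ _ _

/-- The tensor `∑_J a_J e_{J₁} ⊗ ⋯ ⊗ e_{Jₙ}`. -/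
def coeffTensor (a : Multiset A.Idx → ℂ) (n : ℕ) : Tensor n :=
  ∑' J : Fin n → A.Idx, a (tupleMultiset J) •
    (ContinuousMultilinearMap.mkPiAlgebra ℂ (Fin n) ℂ).compContinuousLinearMap
      fun i => bilin (A.eigenvec (J i))

theorem coeffTensor_apply {a : Multiset A.Idx → ℂ} {n : ℕ}
    (h : Summable fun J : Fin n → A.Idx => ‖a (tupleMultiset J)‖) (x : Fin n → ComplexL2) :
    coeffTensor a n x =
      ∑' J : Fin n → A.Idx, a (tupleMultiset J) * ∏ i, bilin (A.eigenvec (J i)) (x i) := by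
  have hs : Summable fun J : Fin n → A.Idx => a (tupleMultiset J) •
      (ContinuousMultilinearMap.mkPiAlgebra ℂ (Fin n) ℂ).compContinuousLinearMap
        fun i => bilin (A.eigenvec (J i)) := by
    refine Summable.of_norm_bounded h fun J => ?_
    rw [norm_smul]
    refine mul_le_of_le_one_right (norm_nonneg _) ?_
    refine (ContinuousMultilinearMap.norm_compContinuousLinearMap_le _ _).trans ?_
    simp [A.norm_bilin_eigenvec]
  rw [coeffTensor, ContinuousMultilinearMap.tsum_eval hs]
  simp

theorem coeffTensor_perm {a : Multiset A.Idx → ℂ} {n : ℕ}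
    (h : Summable fun J : Fin n → A.Idx => ‖a (tupleMultiset J)‖) (σ : Equiv.Perm (Fin n))
    (x : Fin n → ComplexL2) : coeffTensor a n (x ∘ σ) = coeffTensor a n x := by
  rw [coeffTensor_apply h, coeffTensor_apply h,
    ← (Equiv.arrowCongr σ.symm (Equiv.refl A.Idx)).tsum_eq]
  refine tsum_congr fun J => ?_
  have : (Equiv.arrowCongr σ.symm (Equiv.refl A.Idx)) J = J ∘ σ := rfl
  rw [this, tupleMultiset_comp_perm]
  congr 1
  exact Equiv.prod_comp σ fun i => bilin (A.eigenvec (J i)) (x i)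

theorem coeffTensor_eigenvec {a : Multiset A.Idx → ℂ} {n : ℕ}
    (h : Summable fun J : Fin n → A.Idx => ‖a (tupleMultiset J)‖) (K : Fin n → A.Idx) :
    (coeffTensor a n fun i => A.eigenvec (K i)) = a (tupleMultiset K) := by
  classical
  rw [coeffTensor_apply h, tsum_eq_single K]
  · simp [A.bilin_eigenvec]
  · intro J hJ
    obtain ⟨i, hi⟩ := Function.ne_iff.1 hJ
    rw [Finset.prod_eq_zero (Finset.mem_univ i), mul_zero]
    simp [A.bilin_eigenvec, hi]

theorem exists_coord_eq (hβ₀ : 0 ≤ β) {a : Multiset A.Idx → ℂ}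
    (h : ∀ p, ∃ M, ∀ α, weight A β p α * ‖a α‖ ≤ M) :
    ∃ f : TestSpace A β, coord f = a := by
  obtain ⟨M, hM⟩ := h (2 * gap A)
  have hs := summable_of_weight_le hβ₀ hM
  refine ⟨⟨coeffTensor a, fun n σ x => coeffTensor_perm (hs n) σ x, fun p => ?_⟩,
    funext fun α => ?_⟩
  · obtain ⟨M', hM'⟩ := h (p + gap A)
    refine (fockNorm_le_of_weight_le (M := M') ?_ _ fun n J => ?_).trans_lt ENNReal.ofReal_lt_top
    · exact (mul_nonneg (weight_pos _ 0).le (norm_nonneg _)).trans (hM' 0)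
    · rw [coeffTensor_eigenvec (hs n)]
      exact hM' _
  · refine (coeffTensor_eigenvec (hs _) _).trans ?_
    rw [tupleMultiset_get]

/-- The test function with coordinates `a`, for rapidly decreasing `a`. -/
def ofCoord (hβ₀ : 0 ≤ β) (a : Multiset A.Idx → ℂ)
    (h : ∀ p, ∃ M, ∀ α, weight A β p α * ‖a α‖ ≤ M) : TestSpace A β :=
  (exists_coord_eq hβ₀ h).choose

@[simp]
theorem coord_ofCoord (hβ₀ : 0 ≤ β) (a : Multiset A.Idx → ℂ)
    (h : ∀ p, ∃ M, ∀ α, weight A β p α * ‖a α‖ ≤ M) : coord (ofCoord hβ₀ a h) = a :=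
  (exists_coord_eq hβ₀ h).choose_spec

/-! ### Convolution operators -/

variable (A)

/-- Since the eigenvalues are bounded below by some `ρ > 1`, exponential factors in the degree, such
as binomial coefficients, are absorbed by raising `p`. -/
theorem exists_two_pow_card_le : ∃ r : ℝ, ∀ α : Multiset A.Idx,
    2 ^ Multiset.card α ≤ (α.map fun j => A.eigenvalue j ^ r).prod := by
  obtain ⟨ρ, hρ, hρ'⟩ := A.exists_one_lt_le_eigenvalue
  obtain ⟨n, hn⟩ := pow_unbounded_of_one_lt 2 hρ
  refine ⟨n, fun α => ?_⟩
  induction α using Multiset.induction_on with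
  | empty => simp
  | cons j α ih =>
    rw [Multiset.card_cons, pow_succ', Multiset.map_cons, Multiset.prod_cons]
    have : 2 ≤ A.eigenvalue j ^ (n : ℝ) := by
      rw [Real.rpow_natCast]
      exact hn.le.trans (pow_le_pow_left₀ (by linarith) (hρ' j) n)
    gcongr

/-- An exponent `r` with `2 ≤ λ_j^r` for all `j`. -/
def dblExp : ℝ := (exists_two_pow_card_le A).choose

theorem two_pow_card_le (α : Multiset A.Idx) :
    2 ^ Multiset.card α ≤ (α.map fun j => A.eigenvalue j ^ dblExp A).prod :=
  (exists_two_pow_card_le A).choose_spec α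

variable {A}

theorem weight_add (p q : ℝ) (α : Multiset A.Idx) :
    weight A β (p + q) α = weight A β p α * (α.map fun j => A.eigenvalue j ^ q).prod := by
  rw [weight, weight, prod_eigenvalue_rpow_add, mul_assoc]

/-- The eigenvalue products are multiplicative, `|γ|! |α|! ≤ |α + γ|!` handles the factorials, and
the binomial coefficient is at most `2^{|α + γ|}`. -/
theorem weight_mul_weight_mul_choose_le (hβ₀ : 0 ≤ β) (p : ℝ) (γ α : Multiset A.Idx) :
    weight A β p γ * weight A β p α *
      ((Multiset.card (α + γ)).choose (Multiset.card γ) : ℝ) ≤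
      weight A β (p + dblExp A) (α + γ) := by
  have h1 : weight A β p γ * weight A β p α ≤ weight A β p (α + γ) := by
    have h2 : ((Multiset.card γ).factorial : ℝ) * (Multiset.card α).factorial ≤
        (Multiset.card (α + γ)).factorial := by
      rw [Multiset.card_add, add_comm]
      exact_mod_cast Nat.le_of_dvd (Nat.factorial_pos _)
        (Nat.factorial_mul_factorial_dvd_factorial_add _ _)
    have h3 := Real.rpow_le_rpow (by positivity) h2 (show 0 ≤ (1 + β) / 2 by linarith)
    rw [Real.mul_rpow (by positivity) (by positivity)] at h3
    have h4 := prod_eigenvalue_rpow_pos A p γ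
    have h5 := prod_eigenvalue_rpow_pos A p α
    have h6 := mul_le_mul_of_nonneg_right h3 (mul_pos h4 h5).le
    simp only [weight]
    rw [Multiset.map_add, Multiset.prod_add]
    linarith
  rw [weight_add]
  refine mul_le_mul h1 (le_trans ?_ (two_pow_card_le A _)) (by positivity) (weight_pos _ _).le
  exact_mod_cast Nat.choose_le_two_pow _ _

/-- The central estimate. The exponents `p` and `q` are independent: `q` will be dictated by the
order of the functional, while `p` is any desired decay in `γ`. -/
theorem weight_mul_shift_le (hβ₀ : 0 ≤ β) (p q : ℝ) (f : TestSpace A β) (γ α : Multiset A.Idx) :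
    weight A β p γ * (weight A β q α *
      ‖((Multiset.card (α + γ)).choose (Multiset.card γ) : ℂ) * coord f (α + γ)‖) ≤
      testNorm A β (max p q + dblExp A) f := by
  refine le_trans ?_ (weight_mul_coord_le _ f (α + γ))
  have h1 := weight_mul_weight_mul_choose_le hβ₀ (max p q) γ α
  have h2 := weight_mono (A := A) (β := β) (le_max_left p q) γ
  have h3 := weight_mono (A := A) (β := β) (le_max_right p q) α
  have h4 := weight_pos (A := A) (β := β) p γ
  have h5 := weight_pos (A := A) (β := β) q α
  rw [norm_mul, Complex.norm_natCast, ← mul_assoc, ← mul_assoc]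
  gcongr
  refine le_trans ?_ h1
  have h6 := h4.le.trans h2
  gcongr

/-- The test function with coordinates `α ↦ (|α + γ| choose |γ|) f_{α + γ}`; up to a factor, the
derivative of `f` of order `γ`. -/
def shift (hβ₀ : 0 ≤ β) (γ : Multiset A.Idx) : TestSpace A β →ₗ[ℂ] TestSpace A β where
  toFun f := ofCoord hβ₀
    (fun α => ((Multiset.card (α + γ)).choose (Multiset.card γ) : ℂ) * coord f (α + γ))
    fun p => ⟨testNorm A β (max p p + dblExp A) f / weight A β p γ, fun α => by
      rw [le_div_iff₀' (weight_pos _ _)]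
      exact weight_mul_shift_le hβ₀ p p f γ α⟩
  map_add' f g := coord_injective <| funext fun α => by
    simp only [coord_add, coord_ofCoord, mul_add]
  map_smul' c f := coord_injective <| funext fun α => by
    simp only [coord_smul, coord_ofCoord, RingHom.id_apply]
    ring

theorem coord_shift (hβ₀ : 0 ≤ β) (γ α : Multiset A.Idx) (f : TestSpace A β) :
    coord (shift hβ₀ γ f) α =
      ((Multiset.card (α + γ)).choose (Multiset.card γ) : ℂ) * coord f (α + γ) := by
  simp only [shift, LinearMap.coe_mk, AddHom.coe_mk, coord_ofCoord]

theorem weight_mul_testNorm_shift_le (hβ₀ : 0 ≤ β) (p q : ℝ) (f : TestSpace A β)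
    (γ : Multiset A.Idx) : weight A β p γ * testNorm A β q (shift hβ₀ γ f) ≤
      2 * testNorm A β (max p (q + gap A) + dblExp A) f := by
  have hw := weight_pos (A := A) (β := β) p γ
  rw [← le_div_iff₀' hw, mul_div_assoc]
  refine testNorm_le_of_weight_le (by positivity) _ fun α => ?_
  rw [le_div_iff₀' hw, coord_shift]
  exact weight_mul_shift_le hβ₀ _ _ f γ α

/-- Continuity gives a bound by finitely many norms; as the norms increase with `p`, one of them
suffices. -/
theorem exists_norm_le_testNorm (φ : Distributions A β) :
    ∃ q C : ℝ, 0 ≤ C ∧ ∀ f, ‖φ f‖ ≤ C * testNorm A β q f := by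
  obtain ⟨s, C, -, hC⟩ := Seminorm.bound_of_continuous (testSpace_withSeminorms A β)
    ((normSeminorm ℂ ℂ).comp φ.toLinearMap) (continuous_norm.comp φ.continuous)
  obtain ⟨q, hq⟩ := s.exists_le
  refine ⟨q, C, C.2, fun f => (hC f).trans ?_⟩
  have h1 : s.sup (testNorms A β) ≤ testNorm A β q :=
    Finset.sup_le fun p hp => testNorm_mono (hq p hp)
  exact mul_le_mul_of_nonneg_left (h1 f) C.2

theorem weight_mul_norm_shift_le (hβ₀ : 0 ≤ β) (φ : Distributions A β) :
    ∃ q C : ℝ, 0 ≤ C ∧ ∀ p f γ, weight A β p γ * ‖φ (shift hβ₀ γ f)‖ ≤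
      C * testNorm A β (max p (q + gap A) + dblExp A) f := by
  obtain ⟨q, C, hC, h⟩ := exists_norm_le_testNorm φ
  refine ⟨q, C * 2, by positivity, fun p f γ => ?_⟩
  have hw := weight_pos (A := A) (β := β) p γ
  calc weight A β p γ * ‖φ (shift hβ₀ γ f)‖
      ≤ weight A β p γ * (C * testNorm A β q (shift hβ₀ γ f)) := by gcongr; exact h _
    _ = C * (weight A β p γ * testNorm A β q (shift hβ₀ γ f)) := by ring
    _ ≤ C * (2 * testNorm A β (max p (q + gap A) + dblExp A) f) := by
      exact mul_le_mul_of_nonneg_left (weight_mul_testNorm_shift_le hβ₀ p q f γ) hC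
    _ = _ := by ring

/-- The convolution operator `C_φ`, as a linear map. -/
def convₗ (hβ₀ : 0 ≤ β) (φ : Distributions A β) : TestSpace A β →ₗ[ℂ] TestSpace A β where
  toFun f := ofCoord hβ₀ (fun γ => φ (shift hβ₀ γ f)) fun p => by
    obtain ⟨q, C, -, h⟩ := weight_mul_norm_shift_le hβ₀ φ
    exact ⟨_, h p f⟩
  map_add' f g := coord_injective <| funext fun α => by
    simp only [coord_add, coord_ofCoord, map_add]
  map_smul' c f := coord_injective <| funext fun α => by
    simp only [coord_smul, coord_ofCoord, RingHom.id_apply, map_smul, smul_eq_mul]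

theorem coord_convₗ (hβ₀ : 0 ≤ β) (φ : Distributions A β) (f : TestSpace A β)
    (γ : Multiset A.Idx) : coord (convₗ hβ₀ φ f) γ = φ (shift hβ₀ γ f) := by
  simp only [convₗ, LinearMap.coe_mk, AddHom.coe_mk, coord_ofCoord]

theorem continuous_convₗ (hβ₀ : 0 ≤ β) (φ : Distributions A β) : Continuous (convₗ hβ₀ φ) := by
  refine (testSpace_withSeminorms A β).continuous_of_isBounded (testSpace_withSeminorms A β) _ ?_
  intro p
  obtain ⟨q, C, hC, h⟩ := weight_mul_norm_shift_le hβ₀ φ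
  refine ⟨{max (p + gap A) (q + gap A) + dblExp A}, ⟨2 * C, by positivity⟩, fun f => ?_⟩
  rw [Finset.sup_singleton]
  change testNorm A β p (convₗ hβ₀ φ f) ≤ 2 * C * testNorm A β _ f
  rw [mul_assoc]
  refine testNorm_le_of_weight_le (by positivity) _ fun γ => ?_
  rw [coord_convₗ]
  exact h _ f γ

/-- The convolution operator `C_φ`. -/
def conv (hβ₀ : 0 ≤ β) (φ : Distributions A β) : TestSpace A β →L[ℂ] TestSpace A β :=
  ⟨convₗ hβ₀ φ, continuous_convₗ hβ₀ φ⟩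

theorem coord_conv (hβ₀ : 0 ≤ β) (φ : Distributions A β) (f : TestSpace A β)
    (γ : Multiset A.Idx) : coord (conv hβ₀ φ f) γ = φ (shift hβ₀ γ f) :=
  coord_convₗ hβ₀ φ f γ

/-- The map `φ ↦ C_φ`, as a linear map. -/
def convHomₗ (hβ₀ : 0 ≤ β) :
    Distributions A β →ₗ[ℂ] (TestSpace A β →L[ℂ] TestSpace A β) where
  toFun := conv hβ₀
  map_add' φ ψ := ContinuousLinearMap.ext fun f => coord_injective <| funext fun α => by
    simp only [add_apply, coord_add, coord_conv]
  map_smul' c φ := ContinuousLinearMap.ext fun f => coord_injective <| funext fun α => by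
    simp only [smul_apply, coord_smul, coord_conv, RingHom.id_apply, smul_eq_mul]

/-- A functional that is small on this bounded set has all `weight p γ * ‖φ (shift γ f)‖` small,
uniformly for `f ∈ S`; these are the weighted coordinates of `C_φ f`. -/
theorem isVonNBounded_weight_smul_shift (hβ₀ : 0 ≤ β) (p : ℝ) {S : Set (TestSpace A β)}
    (hS : Bornology.IsVonNBounded ℂ S) : Bornology.IsVonNBounded ℂ
      (Set.image2 (fun γ f => (weight A β p γ : ℂ) • shift hβ₀ γ f) Set.univ S) := by
  rw [(testSpace_withSeminorms A β).isVonNBounded_iff_seminorm_bounded] at hS ⊢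
  intro q
  obtain ⟨r, hr, h⟩ := hS (max p (q + gap A) + dblExp A)
  refine ⟨2 * r, by positivity, ?_⟩
  rintro _ ⟨γ, -, f, hf, rfl⟩
  change testNorm A β q _ < _
  rw [map_smul_eq_mul, Complex.norm_real, Real.norm_of_nonneg (weight_pos _ _).le]
  refine (weight_mul_testNorm_shift_le hβ₀ p q f γ).trans_lt ?_
  have := h f hf
  change testNorm A β _ f < r at this
  linarith

theorem continuous_convHomₗ (hβ₀ : 0 ≤ β) : Continuous (convHomₗ (A := A) hβ₀) := by
  refine continuous_of_continuousAt_zero _ ?_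
  rw [ContinuousAt, map_zero]
  have hb := ContinuousLinearMap.hasBasis_nhds_zero_of_basis (σ := RingHom.id ℂ)
    (E := TestSpace A β) (testSpace_withSeminorms A β).hasBasis_zero_ball
  have hb' := ContinuousLinearMap.hasBasis_nhds_zero_of_basis (σ := RingHom.id ℂ)
    (E := TestSpace A β) (F := ℂ) Metric.nhds_basis_ball
  refine (hb'.tendsto_iff hb).2 ?_
  rintro ⟨S, s, r⟩ ⟨hS, hr⟩
  simp only at hS hr
  obtain ⟨p, hp⟩ := s.exists_le
  -- Passing from sup norms to `testNorm` costs `gap A` and a factor 2, so `r / 4` yields `r / 2 <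
  -- r`.
  refine ⟨(_, r / 4), ⟨isVonNBounded_weight_smul_shift hβ₀ (p + gap A) hS, by positivity⟩,
    fun φ hφ f hf => ?_⟩
  rw [Seminorm.mem_ball_zero]
  have h1 : s.sup (testNorms A β) ≤ testNorm A β p :=
    Finset.sup_le fun q hq => testNorm_mono (hp q hq)
  refine (h1 _).trans_lt ?_
  refine (testNorm_le_of_weight_le (M := r / 4) (by positivity) _ fun γ => ?_).trans_lt
    (by linarith)
  have h2 := hφ _ ⟨γ, trivial, f, hf, rfl⟩
  rw [map_smul, mem_ball_zero_iff, norm_smul, Complex.norm_real,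
    Real.norm_of_nonneg (weight_pos _ _).le] at h2
  refine le_trans (le_of_eq ?_) h2.le
  congr 2
  exact coord_conv hβ₀ φ f γ

/-- The map `φ ↦ C_φ`. -/
def convHom (hβ₀ : 0 ≤ β) : Distributions A β →L[ℂ] (TestSpace A β →L[ℂ] TestSpace A β) :=
  ⟨convHomₗ hβ₀, continuous_convHomₗ hβ₀⟩

/-- The coordinates as continuous linear forms. -/
def coordL (α : Multiset A.Idx) : Distributions A β :=
  ⟨coordₗ α, by
    have hw := weight_pos (A := A) (β := β) 0 α
    refine (testSpace_withSeminorms A β).continuous_normedSpace_rng ℂ _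
      ⟨{0}, ⟨(weight A β 0 α)⁻¹, by positivity⟩, fun f => ?_⟩
    rw [Finset.sup_singleton]
    change ‖coord f α‖ ≤ (weight A β 0 α)⁻¹ * testNorm A β 0 f
    rw [le_inv_mul_iff₀ hw]
    exact weight_mul_coord_le 0 f α⟩

/-- The vacuum expectation `f ↦ f₀`. -/
def vacuum : Distributions A β := coordL 0

theorem vacuum_apply (f : TestSpace A β) : vacuum f = coord f 0 := rfl

theorem shift_zero (hβ₀ : 0 ≤ β) (f : TestSpace A β) : shift hβ₀ 0 f = f :=
  coord_injective <| funext fun α => by simp [coord_shift]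

theorem vacuum_conv (hβ₀ : 0 ≤ β) (φ : Distributions A β) (f : TestSpace A β) :
    vacuum (conv hβ₀ φ f) = φ f := by
  rw [vacuum_apply, coord_conv, shift_zero]

theorem conv_vacuum (hβ₀ : 0 ≤ β) :
    conv (A := A) hβ₀ vacuum = ContinuousLinearMap.id ℂ (TestSpace A β) :=
  ContinuousLinearMap.ext fun f => coord_injective <| funext fun α => by
    rw [coord_conv, vacuum_apply, coord_shift]
    simp

/-! ### Exponential vectors as joint eigenvectors -/

theorem coord_expVector (hβ : β < 1) (ξ : EC A) (α : Multiset A.Idx) :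
    coord (expVector A hβ ξ) α = ((Multiset.card α).factorial : ℂ)⁻¹ *
      (α.map fun j => bilin ξ (A.eigenvec j)).prod := by
  have h := apply_eigenvec (expVector A hβ ξ) fun i => α.toList.get i
  rw [tupleMultiset_get] at h
  rw [← h]
  refine (expCoeff_apply _ _ _).trans ?_
  rw [← prod_map_tupleMultiset (fun i => α.toList.get i) fun j => bilin ξ (A.eigenvec j),
    tupleMultiset_get, Multiset.length_toList]

/-- The binomial coefficient in `shift` turns `1 / |α + γ|!` into `1 / (|α|! |γ|!)`, so the
coordinates factor. -/
theorem shift_expVector (hβ₀ : 0 ≤ β) (hβ : β < 1) (ξ : EC A) (γ : Multiset A.Idx) :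
    shift hβ₀ γ (expVector A hβ ξ) = coord (expVector A hβ ξ) γ • expVector A hβ ξ := by
  refine coord_injective <| funext fun α => ?_
  simp only [coord_shift, coord_smul, coord_expVector, Multiset.map_add, Multiset.prod_add,
    Multiset.card_add]
  rw [add_comm (Multiset.card α), Nat.cast_add_choose]
  have h : ((Multiset.card γ + Multiset.card α).factorial : ℂ) ≠ 0 :=
    Nat.cast_ne_zero.2 (Nat.factorial_ne_zero _)
  field_simp

theorem conv_expVector (hβ₀ : 0 ≤ β) (hβ : β < 1) (φ : Distributions A β) (ξ : EC A) :
    conv hβ₀ φ (expVector A hβ ξ) = sTransform A hβ φ ξ • expVector A hβ ξ := by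
  refine coord_injective <| funext fun α => ?_
  rw [coord_conv, shift_expVector, map_smul, coord_smul, sTransform, smul_eq_mul, mul_comm]

/-! ### Injectivity of the `S`-transform -/

open Classical in
/-- The test function with a single nonzero coordinate, `1` at `α`. -/
def unitVec (hβ₀ : 0 ≤ β) (α : Multiset A.Idx) : TestSpace A β :=
  ofCoord hβ₀ (Pi.single α 1) fun p => ⟨weight A β p α, fun γ => by
    rcases eq_or_ne γ α with rfl | h
    · simp
    · simp [h, (weight_pos p α).le]⟩

open Classical in
theorem coord_unitVec (hβ₀ : 0 ≤ β) (α : Multiset A.Idx) :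
    coord (unitVec hβ₀ α : TestSpace A β) = Pi.single α 1 :=
  coord_ofCoord _ _ _

theorem hasSum_coord_smul_unitVec (hβ₀ : 0 ≤ β) (f : TestSpace A β) :
    HasSum (fun α => coord f α • unitVec hβ₀ α) f := by
  classical
  refine ((testSpace_withSeminorms A β).tendsto_nhds _ f).2 fun p ε hε => ?_
  set N := testNorm A β (p + gap A + 2 * gap A) f with hN
  have hN0 : 0 ≤ N := apply_nonneg _ _
  -- Outside a finite set the factor gained by lowering the weight exponent by `2 * gap A` is small.
  -- `N + 1` replaces `N`, which may vanish.
  have hfin := (summable_prod_eigenvalue A).tendsto_cofinite_zero.eventually_lt_const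
    (show 0 < ε / (4 * (N + 1)) by positivity)
  rw [Filter.eventually_cofinite] at hfin
  filter_upwards [Filter.eventually_ge_atTop hfin.toFinset] with s hs
  refine (testNorm_le_of_weight_le (M := ε / 4) (by positivity) _ fun γ => ?_).trans_lt
    (by linarith)
  have h1 : coord (∑ α ∈ s, coord f α • unitVec hβ₀ α - f) γ =
      (if γ ∈ s then coord f γ else 0) - coord f γ := by
    change coordₗ γ (∑ α ∈ s, coord f α • unitVec hβ₀ α - f) = _
    rw [map_sub, map_sum]
    congr 1
    simp only [map_smul, smul_eq_mul]
    change ∑ α ∈ s, coord f α * coord (unitVec hβ₀ α) γ = _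
    simp [coord_unitVec, Pi.single_apply]
  rw [h1]
  split_ifs with hγ
  · simp only [sub_self, norm_zero, mul_zero]; positivity
  · have h2 : (γ.map fun j => A.eigenvalue j ^ (-(2 * gap A))).prod < ε / (4 * (N + 1)) := by
      by_contra h
      exact hγ (hs (by simpa using h))
    have h3 := weight_mul_coord_le (p + gap A + 2 * gap A) f γ
    have h4 := weight_add (β := β) (p + gap A + 2 * gap A) (-(2 * gap A)) γ
    rw [add_neg_cancel_right] at h4
    have h5 := prod_eigenvalue_rpow_pos A (-(2 * gap A)) γ
    rw [zero_sub, norm_neg, h4, mul_right_comm]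
    calc _ ≤ N * (ε / (4 * (N + 1))) := by gcongr
      _ ≤ (N + 1) * (ε / (4 * (N + 1))) := by gcongr; linarith
      _ = ε / 4 := by field_simp

theorem eq_zero_of_hasSum_pow_mul {b : ℕ → ℂ} (h : ∀ t : ℂ, HasSum (fun n => t ^ n * b n) 0)
    (n : ℕ) : b n = 0 := by
  have h1 : HasFPowerSeriesAt (0 : ℂ → ℂ) (FormalMultilinearSeries.ofScalars ℂ b) 0 := by
    rw [hasFPowerSeriesAt_iff]
    refine Filter.Eventually.of_forall fun t => ?_
    simpa [FormalMultilinearSeries.coeff_ofScalars] using h t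
  have h2 := congrArg (fun p => FormalMultilinearSeries.coeff p n) h1.eq_zero
  simp only [FormalMultilinearSeries.coeff_ofScalars] at h2
  exact h2

theorem eval_monomial_toFinsupp {ι : Type} [DecidableEq ι] (z : ι → ℂ) (α : Multiset ι) (c : ℂ) :
    MvPolynomial.eval z (MvPolynomial.monomial (Multiset.toFinsupp α) c) =
      c * (α.map z).prod := by
  rw [MvPolynomial.eval_monomial, Finset.prod_multiset_map_count, Finsupp.prod,
    Multiset.toFinsupp_support]
  simp

/-- The coefficients of a power series in arbitrarily many variables which vanishes at all finitely
supported points are zero. -/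
theorem eq_zero_of_hasSum_mul_prod {ι : Type} {c : Multiset ι → ℂ}
    (h : ∀ (T : Finset ι) (z : ι → ℂ), (∀ j ∉ T, z j = 0) →
      HasSum (fun α => c α * (α.map z).prod) 0) (α : Multiset ι) : c α = 0 := by
  classical
  set T := α.toFinset
  set n := Multiset.card α
  -- The finitely many monomials of degree `n` in the variables of `T`; `α` is one of them.
  let Q : Finset (Multiset ι) := (T.sym n).image fun m : Sym ι n => (m : Multiset ι)
  have hQ : ∀ γ, γ ∈ Q ↔ Multiset.card γ = n ∧ ∀ j ∈ γ, j ∈ T := by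
    intro γ
    refine Finset.mem_image.trans ⟨?_, ?_⟩
    · rintro ⟨m, hm, rfl⟩
      exact ⟨m.2, Finset.mem_sym_iff.1 hm⟩
    · rintro ⟨h1, h2⟩
      exact ⟨⟨γ, h1⟩, Finset.mem_sym_iff.2 h2, rfl⟩
  have hα : α ∈ Q := (hQ α).2 ⟨rfl, fun j hj => Multiset.mem_toFinset.2 hj⟩
  have key : ∀ z : ι → ℂ, ∑ γ ∈ Q, c γ * (γ.map z).prod = 0 := by
    intro z
    let zT : ι → ℂ := fun j => if j ∈ T then z j else 0
    -- Scaling the point by `t` gives a one-variable power series whose coefficients are the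
    -- homogeneous parts; each must vanish by uniqueness of power series.
    have hz : ∀ t : ℂ, HasSum (fun γ => t ^ Multiset.card γ * (c γ * (γ.map zT).prod)) 0 := by
      intro t
      refine (h T (fun j => t * zT j) fun j hj => by simp [zT, hj]).congr_fun fun γ => ?_
      rw [Multiset.prod_map_mul, Multiset.map_const', Multiset.prod_replicate]
      ring
    let b : ℕ → ℂ := fun m => ∑' γ : {γ : Multiset ι // Multiset.card γ = m},
      c γ * ((γ : Multiset ι).map zT).prod
    have hb : ∀ t : ℂ, HasSum (fun m => t ^ m * b m) 0 := by
      intro t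
      have h1 := (Equiv.sigmaFiberEquiv (Multiset.card : Multiset ι → ℕ)).hasSum_iff.2 (hz t)
      refine h1.sigma fun m => ?_
      have h2 := (hz 1).summable.subtype {γ | Multiset.card γ = m}
      have h3 : Summable fun γ : {γ : Multiset ι // Multiset.card γ = m} =>
          c γ * ((γ : Multiset ι).map zT).prod := by
        simp only [Function.comp_def, one_pow, one_mul] at h2
        exact h2
      refine (h3.hasSum.mul_left (t ^ m)).congr_fun fun γ => ?_
      simp [Equiv.sigmaFiberEquiv, γ.2]
    have hbn := eq_zero_of_hasSum_pow_mul hb n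
    have h4 : b n = ∑ γ ∈ Q, c γ * (γ.map z).prod := by
      refine (tsum_subtype {γ : Multiset ι | Multiset.card γ = n}
        fun γ => c γ * (γ.map zT).prod).trans ?_
      rw [tsum_eq_sum (s := Q)]
      · refine Finset.sum_congr rfl fun γ hγ => ?_
        rw [hQ] at hγ
        rw [Set.indicator_of_mem (by exact hγ.1)]
        congr 2
        exact Multiset.map_congr rfl fun j hj => by simp [zT, hγ.2 j hj]
      · intro γ hγ
        rw [hQ] at hγ
        by_cases hc : Multiset.card γ = n
        · rw [Set.indicator_of_mem (by exact hc)]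
          push Not at hγ
          obtain ⟨j, hj, hjT⟩ := hγ hc
          rw [Multiset.prod_eq_zero, mul_zero]
          exact Multiset.mem_map.2 ⟨j, hj, by simp [zT, hjT]⟩
        · exact Set.indicator_of_notMem (by exact hc) _
    rw [← h4, hbn]
  -- The homogeneous part of degree `n` is now a polynomial vanishing at every point of the infinite
  -- field `ℂ`, hence the zero polynomial.
  have hp : ∑ γ ∈ Q, MvPolynomial.monomial (Multiset.toFinsupp γ) (c γ) = 0 := by
    refine MvPolynomial.funext fun z => ?_
    rw [map_sum, map_zero, ← key z]
    exact Finset.sum_congr rfl fun γ _ => eval_monomial_toFinsupp z γ _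
  have h5 := congrArg (MvPolynomial.coeff (Multiset.toFinsupp α)) hp
  rw [MvPolynomial.coeff_sum, MvPolynomial.coeff_zero] at h5
  simpa [MvPolynomial.coeff_monomial, hα] using h5

theorem bilin_comm (ξ η : ComplexL2) : bilin ξ η = bilin η ξ := by
  simp only [bilin_apply, mul_comm]

theorem exists_mem_EC (T : Finset A.Idx) (z : A.Idx → ℂ) (hz : ∀ j ∉ T, z j = 0) :
    ∃ ξ : EC A, ∀ j, bilin ξ (A.eigenvec j) = z j := by
  classical
  have h : ∀ j, bilin (∑ i ∈ T, z i • A.eigenvec i) (A.eigenvec j) = z j := by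
    intro j
    have h1 : bilin (∑ i ∈ T, z i • A.eigenvec i) (A.eigenvec j) =
        ∑ i ∈ T, z i * bilin (A.eigenvec i) (A.eigenvec j) := by
      rw [bilin_comm, map_sum]
      refine Finset.sum_congr rfl fun i _ => ?_
      rw [map_smul, smul_eq_mul, bilin_comm]
    rw [h1]
    simp only [A.bilin_eigenvec, mul_ite, mul_one, mul_zero, Finset.sum_ite_eq']
    split_ifs with hj
    · rfl
    · exact (hz j hj).symm
  refine ⟨⟨∑ i ∈ T, z i • A.eigenvec i, fun p => ?_⟩, h⟩
  rw [vecNormSq, tsum_eq_sum (s := T)]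
  · exact ENNReal.sum_lt_top.2 fun j _ =>
      ENNReal.mul_lt_top ENNReal.ofReal_lt_top (ENNReal.pow_lt_top enorm_lt_top)
  · intro j hj
    simp [h, hz j hj]

/-- A functional is determined by its values on the unit vectors, and those values are, up to
factorials, the coefficients of its `S`-transform as a power series in the numbers `⟨ξ, e_j⟩`. -/
theorem sTransform_injective (hβ₀ : 0 ≤ β) (hβ : β < 1) :
    Function.Injective (sTransform A hβ) := by
  intro φ ψ h
  have h1 : ∀ f, HasSum (fun α => coord f α * (φ - ψ) (unitVec hβ₀ α)) ((φ - ψ) f) := by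
    intro f
    have := (hasSum_coord_smul_unitVec hβ₀ f).mapL (φ - ψ)
    simpa using this
  have h2 : ∀ α : Multiset A.Idx,
      ((Multiset.card α).factorial : ℂ)⁻¹ * (φ - ψ) (unitVec hβ₀ α) = 0 := by
    refine eq_zero_of_hasSum_mul_prod fun T z hz => ?_
    obtain ⟨ξ, hξ⟩ := exists_mem_EC T z hz
    have h3 := h1 (expVector A hβ ξ)
    have h4 : (φ - ψ) (expVector A hβ ξ) = 0 := sub_eq_zero.2 (congrFun h ξ)
    rw [h4] at h3
    refine h3.congr_fun fun α => ?_
    rw [coord_expVector]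
    simp only [hξ]
    ring
  rw [← sub_eq_zero]
  refine ContinuousLinearMap.ext fun f => ?_
  refine (h1 f).unique ?_
  have h5 : ∀ α, (φ - ψ) (unitVec hβ₀ α) = 0 := fun α =>
    (mul_eq_zero.1 (h2 α)).resolve_left
      (inv_ne_zero (Nat.cast_ne_zero.2 (Nat.factorial_ne_zero _)))
  simp only [h5, mul_zero]
  exact hasSum_zero

/-! ### The Wick product -/

theorem sTransform_comp_conv (hβ₀ : 0 ≤ β) (hβ : β < 1) (φ ψ : Distributions A β) :
    sTransform A hβ (ψ.comp (conv hβ₀ φ)) = sTransform A hβ φ * sTransform A hβ ψ := by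
  funext ξ
  change ψ (conv hβ₀ φ (expVector A hβ ξ)) = _
  rw [conv_expVector, map_smul, smul_eq_mul]
  rfl

/-- The right side is an explicit preimage of `S(φ) S(ψ)`, so `Function.invFun` does not return its
default value and injectivity identifies it. -/
theorem wick_eq_comp_conv (hβ₀ : 0 ≤ β) (hβ : β < 1) (φ ψ : Distributions A β) :
    wick A hβ φ ψ = ψ.comp (conv hβ₀ φ) := by
  have h : (fun ξ => sTransform A hβ φ ξ * sTransform A hβ ψ ξ) =
      sTransform A hβ (ψ.comp (conv hβ₀ φ)) := (sTransform_comp_conv hβ₀ hβ φ ψ).symm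
  rw [wick, h]
  exact Function.leftInverse_invFun (sTransform_injective hβ₀ hβ) _

theorem sTransform_wick (hβ₀ : 0 ≤ β) (hβ : β < 1) (φ ψ : Distributions A β) :
    sTransform A hβ (wick A hβ φ ψ) = sTransform A hβ φ * sTransform A hβ ψ := by
  rw [wick_eq_comp_conv hβ₀, sTransform_comp_conv]

theorem conv_wick (hβ₀ : 0 ≤ β) (hβ : β < 1) (φ ψ : Distributions A β) :
    conv hβ₀ (wick A hβ φ ψ) = (conv hβ₀ φ).comp (conv hβ₀ ψ) := by
  -- Both sides have `S`-transform `S(φ) S(ψ) S(θ)`; taking the coordinate functionals for `θ` then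
  -- separates points.
  have h : ∀ θ : Distributions A β,
      θ.comp (conv hβ₀ (wick A hβ φ ψ)) = (θ.comp (conv hβ₀ φ)).comp (conv hβ₀ ψ) := by
    intro θ
    apply sTransform_injective hβ₀ hβ
    simp only [sTransform_comp_conv, sTransform_wick hβ₀]
    ring
  exact ContinuousLinearMap.ext fun f => coord_injective <| funext fun γ =>
    DFunLike.congr_fun (h (coordL γ)) f

theorem vacuum_wick (hβ₀ : 0 ≤ β) (hβ : β < 1) (φ : Distributions A β) :
    wick A hβ vacuum φ = φ := by
  rw [wick_eq_comp_conv hβ₀, conv_vacuum, ContinuousLinearMap.comp_id]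

/-- The map `T ↦ (f ↦ (T f)₀)`, which recovers `φ` from `C_φ`. -/
def vacuumComp : (TestSpace A β →L[ℂ] TestSpace A β) →L[ℂ] Distributions A β :=
  ContinuousLinearMap.postcomp (TestSpace A β) vacuum

theorem vacuumComp_convHom (hβ₀ : 0 ≤ β) (φ : Distributions A β) :
    vacuumComp (convHom hβ₀ φ) = φ :=
  ContinuousLinearMap.ext fun f => vacuum_conv hβ₀ φ f

/-- `φ ↦ C_φ`, as a topological isomorphism onto its image. -/
def convEquiv (hβ₀ : 0 ≤ β) :
    Distributions A β ≃L[ℂ] LinearMap.range (convHom (A := A) hβ₀).toLinearMap :=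
  ContinuousLinearEquiv.equivOfInverse
    ((convHom hβ₀).codRestrict _ fun φ => LinearMap.mem_range_self _ φ)
    (vacuumComp.comp (Submodule.subtypeL _))
    (fun φ => vacuumComp_convHom hβ₀ φ)
    (by
      rintro ⟨_, φ, rfl⟩
      exact Subtype.ext (congrArg (convHom hβ₀) (vacuumComp_convHom hβ₀ φ)))

end WhiteNoise

end

open WhiteNoise in
theorem mainTheorem3 (A : TripleOperator) (β : ℝ) (hβ₀ : 0 ≤ β) (hβ : β < 1) :
    -- the Wick product is well defined
    Function.Injective (sTransform A hβ) ∧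
    (∀ φ ψ, sTransform A hβ (wick A hβ φ ψ) = sTransform A hβ φ * sTransform A hβ ψ) ∧
    ∃ (M : Distributions A β → Distributions A β →L[ℂ] Distributions A β)
      (C : Distributions A β →L[ℂ] (TestSpace A β →L[ℂ] TestSpace A β)),
      -- `M φ` is Wick multiplication by `φ`, and `C φ` is the operator whose dual is `M φ`
      (∀ φ ψ, M φ ψ = wick A hβ φ ψ) ∧
      (∀ φ ψ (f : TestSpace A β), ψ (C φ f) = M φ ψ f) ∧
      -- `C` is an injective homomorphism of (unital) algebras
      (∀ φ ψ, C (wick A hβ φ ψ) = (C φ).comp (C ψ)) ∧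
      (∃ ε, (∀ φ, wick A hβ ε φ = φ) ∧ C ε = ContinuousLinearMap.id ℂ (TestSpace A β)) ∧
      Function.Injective C ∧
      -- `C` is a topological isomorphism onto its image
      ∃ e : Distributions A β ≃L[ℂ] LinearMap.range C.toLinearMap, ∀ φ,
        (e φ : TestSpace A β →L[ℂ] TestSpace A β) = C φ := by
  refine ⟨sTransform_injective hβ₀ hβ, sTransform_wick hβ₀ hβ,
    -- Wick multiplication is taken to be the transpose of `C_φ`, so its strong continuity is
    -- automatic and the duality relation holds by `rfl`.
    fun φ => ContinuousLinearMap.precomp ℂ (conv hβ₀ φ), convHom hβ₀,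
    fun φ ψ => (wick_eq_comp_conv hβ₀ hβ φ ψ).symm, fun φ ψ f => rfl, conv_wick hβ₀ hβ,
    ⟨vacuum, vacuum_wick hβ₀ hβ, conv_vacuum hβ₀⟩,
    Function.LeftInverse.injective (g := vacuumComp) (vacuumComp_convHom hβ₀),
    convEquiv hβ₀, fun φ => rfl⟩
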